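/- Let $n\ge 1$, $W=\mathbb{C}^{n-1}$, let $h(u,v)=\sum_j u_j\overline{v_j}$ on $W$, $\omega=\operatorname{Im} h$, and let $J$ be multiplication by $i$ on $W$. Let $\gamma_2:W\to W$, $\gamma_3:\mathbb{C}\to W$, $b_2:W\to\mathbb{R}$, $b_3:\mathbb{C}\to\mathbb{R}$ be $\mathbb{R}$-linear maps such that 1. $\operatorname{Im}\gamma_2+J\operatorname{Im}\gamma_2\subseteq\ker\gamma_2$ and $\omega(\operatorname{Im}\gamma_2,\operatorname{Im}\gamma_2)=0$; 2. $\gamma_2\bigl(s(\gamma_3(is)-J\gamma_3(s))\bigr)=0$ for all $s\in\mathbb{C}$; 3. $b_2(s\gamma_2(u))=2\omega(\gamma_2(u),\gamma_3(s))$ and $b_2\bigl(s(\gamma_3(is)-J\gamma_3(s))\bigr)=2\omega(\gamma_3(is),\gamma_3(s))$ for all $u\in W$, $s\in\mathbb{C}$. Let $U=U(\gamma_2,\gamma_3,b_2,b_3)=\exp\mathfrak{u}$, where $\mathfrak{u}$ is the real Lie algebra of the matrices $$\begin{pmatrix}0&-\overline{\gamma_2(u)+\gamma_3(s)}^{\,t}&i(b_2(u)+b_3(s))&r\\0&0&\gamma_2(u)+\gamma_3(s)&u\\0&0&0&s\\0&0&0&0\end{pmatrix},\qquad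 (r,u,s)\in\mathbb{C}\times W\times\mathbb{C}.$$ These are the unipotent groups, of real dimension $2n+2$, of Hermite-Lorentz affine motions that act simply transitively on $\mathbb{C}^{n+1}$, in suitable coordinates. Let $\mathcal{C}^1U=U$ and $\mathcal{C}^{i+1}U=[\mathcal{C}^iU,U]$ be the lower central series. Let $\Gamma$ be a lattice in $U$, that is, a discrete subgroup such that $\Gamma\backslash U$ carries a nonzero finite $U$-invariant Borel measure. Then there are natural numbers $p,q$ with $\frac{2n+1}{3}\le p\le 2n+2$ and $p+q=2n+2$ such that the manifold $\bigl(\Gamma/(\Gamma\cap\mathcal{C}^2U)\bigr)\backslash\bigl(U/\mathcal{C}^2U\bigr)$ is diffeomorphic to the real torus $\mathbb{R}^p/\mathbb{Z}^p$ and the projection of $\Gamma\backslash U$ onto it is a smooth fibre bundle whose fibre is the real torus $\mathbb{R}^q/\mathbb{Z}^q$. Furthermore this projection is the composition of the projections $$\Gamma\backslash U\longrightarrow \bigl(\Gamma/(\Gamma\cap\mathcal{C}^3U)\bigr)\backslash\bigl(U/\mathcal{C}^3U\bigr)\longrightarrow\bigl(\Gamma/(\Gamma\cap\mathcal{C}^2U)\bigr)\backslash\bigl(U/\mathcal{C}^2U\bigr),$$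 each of which is a smooth fibre bundle, with fibres real tori of dimensions $k$ and $l$ respectively, for some $k,l$ with $k+l=q$. -/

import Mathlib

open scoped ContDiff

noncomputable section

namespace HermiteLorentz

attribute [local instance] LieRing.ofAssociativeRing

/-! ### The Lie algebras `𝔲(γ₂, γ₃, b₂, b₃)` -/

/-- The complex vector space `W = ℂ^{n-1}`. -/
abbrev W (n : ℕ) : Type := Fin (n - 1) → ℂ

/-- The space `V = ℂ × W × ℂ`, with coordinates `(r, u, s)`; its real dimension is `2n + 2`
for `n ≥ 1`. -/
abbrev V (n : ℕ) : Type := ℂ × W n × ℂ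

/-- The form `ω = Im h` on `W`, where `h (u, v) = ∑ j, u j * conj (v j)`. -/
def omega {n : ℕ} (u v : W n) : ℝ := (∑ j, u j * star (v j)).im

/-- The quadruples `(γ₂, γ₃, b₂, b₃)`. The map `J` is multiplication by `i`. -/
structure Datum (n : ℕ) where
  γ₂ : W n →ₗ[ℝ] W n
  γ₃ : ℂ →ₗ[ℝ] W n
  b₂ : W n →ₗ[ℝ] ℝ
  b₃ : ℂ →ₗ[ℝ] ℝ
  /-- `Im γ₂ ⊆ ker γ₂`. -/
  γ₂_γ₂ : ∀ u, γ₂ (γ₂ u) = 0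
  /-- `J (Im γ₂) ⊆ ker γ₂`. -/
  γ₂_J_γ₂ : ∀ u, γ₂ (Complex.I • γ₂ u) = 0
  /-- `ω (Im γ₂, Im γ₂) = 0`. -/
  omega_γ₂ : ∀ u u', omega (γ₂ u) (γ₂ u') = 0
  /-- This and the last condition hold for all `s` if they hold for `s = 1`, both sides being
  multiplied by `|s|²` when `1` is replaced by `s`. They say that `𝔲` is closed under brackets. -/
  γ₂_γ₃ : ∀ s : ℂ, γ₂ (s • (γ₃ (Complex.I * s) - Complex.I • γ₃ s)) = 0
  b₂_γ₂ : ∀ (s : ℂ) (u : W n), b₂ (s • γ₂ u) = 2 * omega (γ₂ u) (γ₃ s)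
  b₂_γ₃ : ∀ s : ℂ, b₂ (s • (γ₃ (Complex.I * s) - Complex.I • γ₃ s)) =
    2 * omega (γ₃ (Complex.I * s)) (γ₃ s)

/-- The four blocks, of sizes `1`, `n - 1`, `1`, `1`. -/
abbrev Idx (n : ℕ) : Type := Unit ⊕ Fin (n - 1) ⊕ Unit ⊕ Unit

namespace Datum

variable {n : ℕ} (D : Datum n)

/-- `γ (u, s) = γ₂ u + γ₃ s`. -/
def γ : V n →ₗ[ℝ] W n where
  toFun v := D.γ₂ v.2.1 + D.γ₃ v.2.2
  map_add' v v' := by simp only [Prod.snd_add, Prod.fst_add, map_add]; abel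
  map_smul' c v := by simp only [Prod.smul_snd, Prod.smul_fst, map_smul, smul_add, RingHom.id_apply]

/-- `b (u, s) = b₂ u + b₃ s`. -/
def b : V n →ₗ[ℝ] ℝ where
  toFun v := D.b₂ v.2.1 + D.b₃ v.2.2
  map_add' v v' := by simp only [Prod.snd_add, Prod.fst_add, map_add]; ring
  map_smul' c v := by simp only [Prod.smul_snd, Prod.smul_fst, map_smul, smul_add, RingHom.id_apply]

open Sum in
/-- The entries of the matrix
`(0, -conj(γ)ᵗ, i b, r ; 0, 0, γ, u ; 0, 0, 0, s ; 0, 0, 0, 0)`. -/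
def entry (v : V n) : Idx n → Idx n → ℂ
  | inl _, inr (inl j) => -star (D.γ v j)
  | inl _, inr (inr (inl _)) => Complex.I * (D.b v : ℂ)
  | inl _, inr (inr (inr _)) => v.1
  | inr (inl j), inr (inr (inl _)) => D.γ v j
  | inr (inl j), inr (inr (inr _)) => v.2.1 j
  | inr (inr (inl _)), inr (inr (inr _)) => v.2.2
  | _, _ => 0

/-- The matrix with entries `D.entry v`; it depends `ℝ`-linearly on `v = (r, u, s)`. -/
def mat : V n →ₗ[ℝ] Matrix (Idx n) (Idx n) ℂ where
  toFun v := Matrix.of (D.entry v)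
  map_add' v v' := by
    ext i j
    rcases i with _ | i | _ | _ <;> rcases j with _ | j | _ | _ <;>
      simp [entry]
    all_goals ring
  map_smul' c v := by
    ext i j
    rcases i with _ | i | _ | _ <;> rcases j with _ | j | _ | _ <;>
      simp [entry]
    all_goals ring

theorem swap_eq (s s' : ℂ) : s' • D.γ₃ s - s • D.γ₃ s' =
    (s'.re * s.im - s'.im * s.re) •
      ((1 : ℂ) • (D.γ₃ (Complex.I * 1) - Complex.I • D.γ₃ 1)) := by
  have h : ∀ z : ℂ, D.γ₃ z = z.re • D.γ₃ 1 + z.im • D.γ₃ Complex.I := by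
    intro z
    rw [← map_smul, ← map_smul, ← map_add]
    congr 1
    apply Complex.ext <;> simp
  rw [h s, h s']
  ext j
  simp only [Pi.sub_apply, Pi.smul_apply, Pi.add_apply, smul_eq_mul, mul_one, one_mul,
    Complex.real_smul]
  conv_lhs => rw [← Complex.re_add_im s, ← Complex.re_add_im s']
  simp only [Complex.add_re, Complex.add_im, Complex.mul_re, Complex.mul_im, Complex.ofReal_re,
    Complex.ofReal_im, Complex.I_re, Complex.I_im]
  push_cast
  ring

theorem γ_swap (v v' : V n) (r : ℂ) :
    D.γ (r, v'.2.2 • D.γ v - v.2.2 • D.γ v', 0) = 0 := by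
  have key : ∀ (z : ℂ) (u : W n), D.γ₂ (z • D.γ₂ u) = 0 := by
    intro z u
    have : z • D.γ₂ u = z.re • D.γ₂ u + z.im • (Complex.I • D.γ₂ u) := by
      ext j
      simp only [Pi.smul_apply, Pi.add_apply, smul_eq_mul, Complex.real_smul]
      conv_lhs => rw [← Complex.re_add_im z]
      ring
    rw [this, map_add, map_smul, map_smul, D.γ₂_γ₂, D.γ₂_J_γ₂]; simp
  have h3 := D.swap_eq v.2.2 v'.2.2
  have : v'.2.2 • D.γ v - v.2.2 • D.γ v' = v'.2.2 • D.γ₂ v.2.1 - v.2.2 • D.γ₂ v'.2.1 +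
      (v'.2.2 • D.γ₃ v.2.2 - v.2.2 • D.γ₃ v'.2.2) := by
    simp only [γ, LinearMap.coe_mk, AddHom.coe_mk, smul_add]; abel
  rw [this, h3]
  have h4 := D.γ₂_γ₃ 1
  simp only [γ, LinearMap.coe_mk, AddHom.coe_mk, map_add, map_sub, map_smul, key, map_zero, h4]
  simp

theorem omega_eq (u v : W n) : omega u v = ∑ j, ((u j).im * (v j).re - (u j).re * (v j).im) := by
  simp only [omega, Complex.im_sum]
  refine Finset.sum_congr rfl fun j _ => ?_
  simp; ring

theorem omega_add_add (u u' v v' : W n) : omega (u + u') (v + v') =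
    omega u v + omega u v' + omega u' v + omega u' v' := by
  simp only [omega_eq, ← Finset.sum_add_distrib]
  refine Finset.sum_congr rfl fun j _ => ?_
  simp; ring

theorem omega_antisymm (u v : W n) : omega u v = -omega v u := by
  simp only [omega_eq, ← Finset.sum_neg_distrib]
  refine Finset.sum_congr rfl fun j _ => ?_
  ring

theorem omega_γ₃ (s s' : ℂ) : omega (D.γ₃ s) (D.γ₃ s') =
    (s'.re * s.im - s'.im * s.re) * omega (D.γ₃ (Complex.I * 1)) (D.γ₃ 1) := by
  have h : ∀ z : ℂ, D.γ₃ z = z.re • D.γ₃ 1 + z.im • D.γ₃ (Complex.I * 1) := by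
    intro z
    rw [← map_smul, ← map_smul, ← map_add]
    congr 1
    apply Complex.ext <;> simp
  rw [h s, h s']
  simp only [omega_eq, Finset.mul_sum]
  refine Finset.sum_congr rfl fun j _ => ?_
  simp; ring

theorem b_swap (v v' : V n) (r : ℂ) :
    D.b (r, v'.2.2 • D.γ v - v.2.2 • D.γ v', 0) = 2 * omega (D.γ v) (D.γ v') := by
  have h3 := D.swap_eq v.2.2 v'.2.2
  have : v'.2.2 • D.γ v - v.2.2 • D.γ v' = v'.2.2 • D.γ₂ v.2.1 - v.2.2 • D.γ₂ v'.2.1 +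
      (v'.2.2 • D.γ₃ v.2.2 - v.2.2 • D.γ₃ v'.2.2) := by
    simp only [γ, LinearMap.coe_mk, AddHom.coe_mk, smul_add]; abel
  rw [this, h3]
  have h4 := D.b₂_γ₃ 1
  have h5 := D.omega_γ₃ v.2.2 v'.2.2
  have h6 := omega_antisymm (D.γ₂ v'.2.1) (D.γ₃ v.2.2)
  simp only [γ, b, LinearMap.coe_mk, AddHom.coe_mk, map_add, map_sub, map_smul, map_zero, h4,
    omega_add_add, D.omega_γ₂, D.b₂_γ₂, h5, h6, smul_eq_mul]
  ring

theorem bracket_eq (v v' : V n) : ⁅D.mat v, D.mat v'⁆ = D.mat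
    (∑ j, star (D.γ v' j) * v.2.1 j - ∑ j, star (D.γ v j) * v'.2.1 j +
      Complex.I * (v'.2.2 * D.b v - v.2.2 * D.b v'),
     v'.2.2 • D.γ v - v.2.2 • D.γ v', 0) := by
  rw [Ring.lie_def]
  ext i j
  rcases i with _ | i | _ | _ <;> rcases j with _ | j | _ | _ <;>
    simp [mat, entry, Matrix.mul_apply, Fintype.sum_sum_type, γ_swap, b_swap]
  · apply Complex.ext
    · simp
      rw [← Finset.sum_neg_distrib, ← Finset.sum_add_distrib]
      exact Finset.sum_eq_zero fun j _ => by ring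
    · simp
      rw [omega_eq, ← Finset.sum_neg_distrib, ← Finset.sum_add_distrib, Finset.mul_sum]
      exact Finset.sum_congr rfl fun j _ => by ring
  all_goals ring

/-- The Lie algebra `𝔲(γ₂, γ₃, b₂, b₃)`. -/
def lieAlgebra : LieSubalgebra ℝ (Matrix (Idx n) (Idx n) ℂ) where
  __ := LinearMap.range D.mat
  lie_mem' := by
    rintro _ _ ⟨v, rfl⟩ ⟨v', rfl⟩
    exact ⟨_, (D.bracket_eq v v').symm⟩

/-- The position of a block. -/
def rk : Idx n → ℕ
  | .inl _ => 0
  | .inr (.inl _) => 1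
  | .inr (.inr (.inl _)) => 2
  | .inr (.inr (.inr _)) => 3

theorem mat_apply_eq_zero (v : V n) (i j : Idx n) (h : rk j < rk i + 1) : D.mat v i j = 0 := by
  rcases i with _ | i | _ | _ <;> rcases j with _ | j | _ | _ <;>
    simp_all [rk, mat, entry]

theorem mul_apply_eq_zero (k : ℕ) (M : Matrix (Idx n) (Idx n) ℂ)
    (hM : ∀ i j, rk j < rk i + k → M i j = 0) (v : V n) (i j : Idx n)
    (h : rk j < rk i + (k + 1)) : (D.mat v * M) i j = 0 := by
  rw [Matrix.mul_apply]
  refine Finset.sum_eq_zero fun l _ => ?_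
  by_cases hl : rk l < rk i + 1
  · rw [D.mat_apply_eq_zero v i l hl, zero_mul]
  · rw [hM l j (by omega), mul_zero]

theorem mul_mul_mul_eq_zero (v₁ v₂ v₃ v₄ : V n) :
    D.mat v₁ * (D.mat v₂ * (D.mat v₃ * D.mat v₄)) = 0 := by
  ext i j
  refine D.mul_apply_eq_zero 3 _ (D.mul_apply_eq_zero 2 _ (D.mul_apply_eq_zero 1 _
    (D.mat_apply_eq_zero v₄) v₃) v₂) v₁ i j ?_
  have : rk j ≤ 3 := by rcases j with _ | j | _ | _ <;> simp [rk]
  omega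

theorem exp_mat (v : V n) : NormedSpace.exp (D.mat v) = 1 + D.mat v +
    (1 / 2 : ℝ) • (D.mat v * D.mat v) + (1 / 6 : ℝ) • (D.mat v * (D.mat v * D.mat v)) := by
  have h4 : ∀ k, 4 ≤ k → D.mat v ^ k = 0 := by
    intro k hk
    obtain ⟨m, rfl⟩ := Nat.exists_eq_add_of_le hk
    rw [pow_add]
    have : D.mat v ^ 4 = 0 := by
      rw [← D.mul_mul_mul_eq_zero v v v v]; noncomm_ring
    rw [this, zero_mul]
  rw [NormedSpace.exp_eq_tsum ℝ]
  beta_reduce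
  rw [tsum_eq_sum (s := Finset.range 4)]
  · simp only [Finset.sum_range_succ, Finset.sum_range_zero, Nat.factorial, pow_zero, pow_succ]
    norm_num [mul_assoc]
  · intro k hk
    rw [h4 k (by simpa using hk), smul_zero]

/-- The Baker-Campbell-Hausdorff formula for four-step nilpotent products. -/
theorem exp_mul_exp (v w : V n) : ∃ z, NormedSpace.exp (D.mat v) * NormedSpace.exp (D.mat w) =
    NormedSpace.exp (D.mat z) := by
  obtain ⟨z₁, h₁⟩ : ∃ z, ⁅D.mat v, D.mat w⁆ = D.mat z := ⟨_, D.bracket_eq v w⟩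
  obtain ⟨z₂, h₂⟩ : ∃ z, ⁅D.mat v, D.mat z₁⁆ = D.mat z := ⟨_, D.bracket_eq v z₁⟩
  obtain ⟨z₃, h₃⟩ : ∃ z, ⁅D.mat w, D.mat z₁⁆ = D.mat z := ⟨_, D.bracket_eq w z₁⟩
  refine ⟨v + w + (1 / 2 : ℝ) • z₁ + (1 / 12 : ℝ) • z₂ - (1 / 12 : ℝ) • z₃, ?_⟩
  rw [D.exp_mat, D.exp_mat, D.exp_mat]
  simp only [map_add, map_sub, map_smul, ← h₂, ← h₃, ← h₁]
  have a := D.mul_mul_mul_eq_zero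
  have q := fun x₁ x₂ x₃ x₄ => a x₁ x₂ x₃ x₄
  generalize hX : D.mat v = X at *
  generalize hY : D.mat w = Y at *
  have e : ∀ A ∈ ({X, Y} : Set (Matrix (Idx n) (Idx n) ℂ)), ∃ x, D.mat x = A := by
    rintro _ (rfl | rfl)
    exacts [⟨v, hX⟩, ⟨w, hY⟩]
  have f : ∀ A ∈ ({X, Y} : Set (Matrix (Idx n) (Idx n) ℂ)), ∀ B ∈ ({X, Y} : Set _),
      ∀ C ∈ ({X, Y} : Set _), ∀ E ∈ ({X, Y} : Set _), A * (B * (C * E)) = 0 := by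
    intro A hA B hB C hC E hE
    obtain ⟨x₁, rfl⟩ := e A hA
    obtain ⟨x₂, rfl⟩ := e B hB
    obtain ⟨x₃, rfl⟩ := e C hC
    obtain ⟨x₄, rfl⟩ := e E hE
    exact a _ _ _ _
  simp only [Set.mem_insert_iff, Set.mem_singleton_iff, forall_eq_or_imp, forall_eq] at f
  clear e a q h₁ h₂ h₃
  clear hX hY
  simp only [Ring.lie_def]
  simp only [mul_add, add_mul, mul_sub, sub_mul, smul_mul_assoc, mul_smul_comm, mul_assoc, f,
    mul_zero, smul_zero, smul_add, smul_sub, one_mul, mul_one, sub_zero, add_zero]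
  module

/-- The exponential `V → GL`, `v ↦ exp (mat v)`. -/
def expGL (v : V n) : GL (Idx n) ℂ where
  val := NormedSpace.exp (D.mat v)
  inv := NormedSpace.exp (D.mat (-v))
  val_inv := by
    rw [map_neg, ← Matrix.exp_add_of_commute _ _ ((Commute.refl (D.mat v)).neg_right), add_neg_cancel,
      NormedSpace.exp_zero]
  inv_val := by
    rw [map_neg, ← Matrix.exp_add_of_commute _ _ ((Commute.refl (D.mat v)).neg_left), neg_add_cancel,
      NormedSpace.exp_zero]

/-- The group `U(γ₂, γ₃, b₂, b₃) = exp 𝔲(γ₂, γ₃, b₂, b₃)`, with the topology of the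
general linear group. -/
def U : Subgroup (GL (Idx n) ℂ) where
  carrier := {g | ∃ X ∈ D.lieAlgebra, (g : Matrix (Idx n) (Idx n) ℂ) = NormedSpace.exp X}
  one_mem' := ⟨0, D.lieAlgebra.zero_mem, by simp⟩
  mul_mem' := by
    rintro g g' ⟨_, ⟨v, rfl⟩, h⟩ ⟨_, ⟨v', rfl⟩, h'⟩
    obtain ⟨z, hz⟩ := D.exp_mul_exp v v'
    exact ⟨_, ⟨z, rfl⟩, by rw [Units.val_mul, h, h', hz]⟩
  inv_mem' := by
    rintro g ⟨_, ⟨v, rfl⟩, h⟩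
    refine ⟨_, ⟨-v, rfl⟩, ?_⟩
    rw [show g = D.expGL v from Units.ext h]
    rfl

/-- The global exponential coordinates `V → U` of the Lie group `U`. -/
def expU (v : V n) : D.U := ⟨D.expGL v, _, ⟨v, rfl⟩, rfl⟩

end Datum

/-! ### Coset spaces `Γ\G` and lattices -/

section Cosets

variable {G H : Type*} [Group G] [Group H]

/-- The space `Γ\G` of the cosets `Γ g`, with the quotient topology. -/
abbrev CosetSpace (Γ : Subgroup G) : Type _ := Quotient (QuotientGroup.rightRel Γ)

/-- The projection `G → Γ\G`. -/
def cosetMk (Γ : Subgroup G) (g : G) : CosetSpace Γ := Quotient.mk _ g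

/-- The map `Γ\G → Δ\H` induced by a homomorphism `f : G → H` with `f(Γ) ⊆ Δ`. -/
def cosetMap {Γ : Subgroup G} {Δ : Subgroup H} (f : G →* H) (h : Γ.map f ≤ Δ) :
    CosetSpace Γ → CosetSpace Δ :=
  Quotient.map f fun x y hxy => by
    have hxy' := QuotientGroup.rightRel_apply.1 hxy
    refine QuotientGroup.rightRel_apply.2 (h ⟨_, hxy', ?_⟩)
    simp

/-- The right translation `Γ x ↦ Γ x g` of `Γ\G`. -/
def rightTranslate (Γ : Subgroup G) (g : G) : CosetSpace Γ → CosetSpace Γ :=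
  Quotient.map (· * g) fun x y hxy => by
    have hxy' := QuotientGroup.rightRel_apply.1 hxy
    refine QuotientGroup.rightRel_apply.2 ?_
    simpa using hxy'

/-- A lattice in `G`: a discrete subgroup `Γ` such that `Γ\G` carries a nonzero finite
`G`-invariant Borel measure. -/
structure IsLattice [TopologicalSpace G] (Γ : Subgroup G) : Prop where
  discrete : DiscreteTopology Γ
  finite_covolume : ∃ ν : @MeasureTheory.Measure (CosetSpace Γ) (borel _),
    ν Set.univ ≠ 0 ∧ ν Set.univ < ⊤ ∧
      ∀ (g : G) (A : Set (CosetSpace Γ)), @MeasurableSet _ (borel _) A →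
        ν (rightTranslate Γ g ⁻¹' A) = ν A

end Cosets

/-! ### Smooth maps and smooth fibre bundles

The smooth structure of a manifold `X` is given by a surjective submersion `c : E → X` from a
finite-dimensional real vector space `E`: a function on an open subset of `X` is smooth if and
only if its composition with `c` is. A map is smooth if it pulls back smooth functions to smooth
functions. -/

section Smooth

variable {E E' E'' X B F : Type*} [NormedAddCommGroup E] [NormedSpace ℝ E]
  [NormedAddCommGroup E'] [NormedSpace ℝ E'] [NormedAddCommGroup E''] [NormedSpace ℝ E'']
  [TopologicalSpace X] [TopologicalSpace B] [TopologicalSpace F]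

/-- The function `f` is smooth on the open subset `O` of `X`. -/
def IsSmoothFun (c : E → X) (O : Set X) (f : X → ℝ) : Prop :=
  ContDiffOn ℝ ∞ (f ∘ c) (c ⁻¹' O)

/-- The continuous map `φ` is smooth on the open subset `O` of `X`. -/
def IsSmoothMapOn (cX : E → X) (cB : E' → B) (O : Set X) (φ : X → B) : Prop :=
  ∀ P : Set B, IsOpen P → ∀ f : B → ℝ, IsSmoothFun cB P f →
    IsSmoothFun cX (O ∩ φ ⁻¹' P) (f ∘ φ)

/-- `X` and `B` are diffeomorphic. -/
def IsDiffeomorphic (cX : E → X) (cB : E' → B) : Prop :=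
  ∃ φ : X ≃ₜ B, IsSmoothMapOn cX cB Set.univ φ ∧ IsSmoothMapOn cB cX Set.univ φ.symm

/-- `π : X → B` is a smooth fibre bundle with fibre `F`: each point of `B` lies in an open set
over which there is a smooth local trivialization. -/
def IsSmoothFiberBundle (cX : E → X) (cB : E' → B) (cF : E'' → F) (π : X → B) : Prop :=
  ∀ x : B, ∃ e : Bundle.Trivialization F π, x ∈ e.baseSet ∧
    IsSmoothMapOn cX (Prod.map cB cF) e.source e ∧
    IsSmoothMapOn (Prod.map cB cF) cX e.target e.toOpenPartialHomeomorph.symm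

/-- The covering `ℝᵏ → ℝᵏ / ℤᵏ` of the torus. -/
def torusMk (k : ℕ) (x : Fin k → ℝ) : UnitAddTorus (Fin k) := fun i => (x i : UnitAddCircle)

end Smooth

/-! ### The quotients of `Γ\U` by the lower central series -/

namespace Datum

variable {n : ℕ} (D : Datum n)

/-- The terms `𝒞ⁱU` of the lower central series: `𝒞¹U = U` and `𝒞ⁱ⁺¹U = [𝒞ⁱU, U]`. -/
def lcs (i : ℕ) : Subgroup D.U := (⊤ : Subgroup D.U).lowerCentralSeries (i - 1)

instance (i : ℕ) : (D.lcs i).Normal := by unfold lcs; infer_instance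

theorem lcs_three_le : D.lcs 3 ≤ D.lcs 2 :=
  Subgroup.lowerCentralSeries_antitone _ (by norm_num)

variable (Γ : Subgroup D.U)

/-- The image `Γ/(Γ ∩ 𝒞ⁱU)` of `Γ` in `U/𝒞ⁱU`. -/
def imageLattice (i : ℕ) : Subgroup (D.U ⧸ D.lcs i) := Γ.map (QuotientGroup.mk' (D.lcs i))

/-- The space `Γ/(Γ ∩ 𝒞ⁱU) \ U/𝒞ⁱU`. -/
abbrev Quot (i : ℕ) : Type := CosetSpace (D.imageLattice Γ i)

/-- The projection `Γ\U → Γ/(Γ ∩ 𝒞ⁱU) \ U/𝒞ⁱU`. -/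
def proj (i : ℕ) : CosetSpace Γ → D.Quot Γ i :=
  cosetMap (QuotientGroup.mk' (D.lcs i)) le_rfl

/-- The projection `Γ/(Γ ∩ 𝒞³U) \ U/𝒞³U → Γ/(Γ ∩ 𝒞²U) \ U/𝒞²U`. -/
def projThreeTwo : D.Quot Γ 3 → D.Quot Γ 2 :=
  cosetMap (QuotientGroup.map (D.lcs 3) (D.lcs 2) (MonoidHom.id D.U) D.lcs_three_le) <| by
    rintro _ ⟨_, ⟨g, hg, rfl⟩, rfl⟩
    exact ⟨g, hg, rfl⟩

/-- The smooth structure of `Γ\U`: the composition `V → U → Γ\U`. -/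
def chart (v : V n) : CosetSpace Γ := cosetMk Γ (D.expU v)

/-- The smooth structure of `Γ/(Γ ∩ 𝒞ⁱU) \ U/𝒞ⁱU`: the composition of `V → U → Γ\U` with the
projection. -/
def quotChart (i : ℕ) (v : V n) : D.Quot Γ i := D.proj Γ i (D.chart Γ v)

end Datum

end HermiteLorentz

end

open Set Filter Topology
open scoped commutatorElement Pointwise

noncomputable section

namespace HermiteLorentz

/-! ### Local lifts and trivializations -/

section LocalLift

variable {E E' X B : Type*} [NormedAddCommGroup E] [NormedSpace ℝ E]
  [NormedAddCommGroup E'] [NormedSpace ℝ E'] [TopologicalSpace B]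

/-! The matrices of the Lie algebra are strictly block upper triangular with four blocks, so a
product of four of them vanishes. Hence `U` is nilpotent of step at most three, the exponential is a
global chart, and the group law is the Baker-Campbell-Hausdorff polynomial. In this chart the second
and third terms of the lower central series are the exponentials of the ideals `derived` and
`derivedThree` (`lowerCentralSeries_one_eq`, `lowerCentralSeries_two_eq`). The derived ideal is
abelian, because `[𝒞², 𝒞²] ⊆ 𝒞⁴ = 0`.

A finite invariant measure on `Γ\U` rules out a surjective continuous homomorphism to `ℝ` that kills
`Γ`, so `log Γ` spans the Lie algebra modulo the derived ideal. By multilinearity the commutators of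
elements of `Γ` then span the two ideals. So `Γ` meets each of the two abelian subgroups in a full
lattice, and its image modulo each of them is discrete. Every successive quotient `I / J` therefore
has linear coordinates in which `Γ ∩ exp I` becomes `ℤᵏ` (`nonempty_latticeCoordinates`). A linear
section of `V → V / I` turns these into fibre coordinates, and discreteness modulo `I` makes the
trivialization work locally (`LatticeCoordinates.isSmoothFiberBundle`).

For the bound on `p`, the image of `γ₂` is isotropic for `ω`, hence totally real, and its complex
span lies in the kernel of `γ₂`. Thus `3 rk γ₂ ≤ 2 (n - 1)`. Brackets have last coordinate zero, and
their middle coordinate lies in that complex span enlarged by one real line. -/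

/-- On `O`, the map `φ : X → B` lifts locally to smooth maps between the covering spaces. -/
def HasSmoothLiftsOn (cX : E → X) (cB : E' → B) (O : Set X) (φ : X → B) : Prop :=
  ∀ x, cX x ∈ O → ∃ Φ : E → E', ContDiffAt ℝ ∞ Φ x ∧ ∀ᶠ y in 𝓝 x, φ (cX y) = cB (Φ y)

theorem HasSmoothLiftsOn.isSmoothMapOn {cX : E → X} {cB : E' → B} {O : Set X} {φ : X → B}
    (h : HasSmoothLiftsOn cX cB O φ) (hB : Continuous cB) : IsSmoothMapOn cX cB O φ := by
  intro P hP f hf x hx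
  obtain ⟨Φ, hΦ, he⟩ := h x hx.1
  refine ContDiffAt.contDiffWithinAt ?_
  have hmem : cB (Φ x) ∈ P := by
    rw [← he.self_of_nhds]; exact hx.2
  have h1 : ContDiffAt ℝ ∞ (f ∘ cB) (Φ x) :=
    (hf (Φ x) hmem).contDiffAt ((hP.preimage hB).mem_nhds hmem)
  refine (h1.comp x hΦ).congr_of_eventuallyEq ?_
  filter_upwards [he] with y hy
  simp [hy]

variable [TopologicalSpace X]

theorem HasSmoothLiftsOn.continuousOn {cX : E → X} {cB : E' → B} {O : Set X} {φ : X → B}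
    (h : HasSmoothLiftsOn cX cB O φ) (hX : IsOpenQuotientMap cX) (hB : Continuous cB) :
    ContinuousOn φ O := by
  intro z hz
  obtain ⟨x, rfl⟩ := hX.surjective z
  obtain ⟨Φ, hΦ, he⟩ := h x hz
  refine ContinuousAt.continuousWithinAt ?_
  rw [ContinuousAt, ← hX.map_nhds_eq, tendsto_map'_iff]
  have h1 : Tendsto (fun y => cB (Φ y)) (𝓝 x) (𝓝 (cB (Φ x))) :=
    (hB.continuousAt.comp hΦ.continuousAt)
  rw [he.self_of_nhds]
  exact h1.congr' (he.mono fun y hy => hy.symm)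

/-- A bijection with smooth lifts in both directions is a diffeomorphism. -/
theorem isDiffeomorphic_of_hasSmoothLiftsOn {cX : E → X} {cB : E' → B} (hX : IsOpenQuotientMap cX)
    (hB : IsOpenQuotientMap cB) (φ : X ≃ B) (h : HasSmoothLiftsOn cX cB univ φ)
    (h' : HasSmoothLiftsOn cB cX univ φ.symm) : IsDiffeomorphic cX cB :=
  ⟨{ φ with
      continuous_toFun := continuousOn_univ.1 (h.continuousOn hX hB.continuous)
      continuous_invFun := continuousOn_univ.1 (h'.continuousOn hB hX.continuous) },
    h.isSmoothMapOn hB.continuous, h'.isSmoothMapOn hX.continuous⟩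

end LocalLift

section Torus

theorem isOpenQuotientMap_torusMk (k : ℕ) : IsOpenQuotientMap (torusMk k) := by
  have h : torusMk k = Pi.map fun (_ : Fin k) (x : ℝ) => (x : UnitAddCircle) := rfl
  rw [h]
  exact IsOpenQuotientMap.piMap fun _ => QuotientAddGroup.isOpenQuotientMap_mk

theorem torusMk_eq_iff {k : ℕ} (x y : Fin k → ℝ) :
    torusMk k x = torusMk k y ↔ ∃ m : Fin k → ℤ, x - y = fun i => (m i : ℝ) := by
  have h : ∀ a b : ℝ, (a : UnitAddCircle) = b ↔ ∃ m : ℤ, a - b = m := by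
    intro a b
    rw [← sub_eq_zero, ← AddCircle.coe_sub, AddCircle.coe_eq_zero_iff]
    simp [eq_comm]
  simp only [torusMk, funext_iff, h, Pi.sub_apply]
  exact Classical.skolem

end Torus

/-- The local trivialization over `cB '' O` of the projection `π : X → B`, where `E → X` and
`E → B` are quotients by the relations generated by the action `act`, by `R` and by `lam`. -/
theorem isSmoothFiberBundle_of_local_coordinates {E X B Γ : Type*} [NormedAddCommGroup E]
    [NormedSpace ℝ E] [TopologicalSpace X] [TopologicalSpace B] {k : ℕ}
    {cX : E → X} {cB : E → B} {π : X → B} (hX : IsOpenQuotientMap cX) (hB : IsOpenQuotientMap cB)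
    (hπ : ∀ v, π (cX v) = cB v) (act : Γ → E → E) (hact : ∀ a, ContDiff ℝ ∞ (act a))
    (hactX : ∀ a v, cX (act a v) = cX v) (R : E → E → Prop) (hRs : ∀ v w, R v w → R w v)
    (hRt : ∀ v w z, R v w → R w z → R v z)
    (hcB : ∀ v w, cB v = cB w ↔ ∃ a, R (act a v) w)
    (lam : E → Fin k → ℝ) (hlam : ContDiff ℝ ∞ lam)
    (hlamX : ∀ v w, R v w → (cX v = cX w ↔ torusMk k (lam v) = torusMk k (lam w)))
    (mu : E × (Fin k → ℝ) → E) (hmu : ContDiff ℝ ∞ mu) (hmuR : ∀ v t, R (mu (v, t)) v)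
    (hmulam : ∀ v t, lam (mu (v, t)) = t)
    (hO : ∀ v, ∃ O : Set E, IsOpen O ∧ v ∈ O ∧ (∀ x y, R x y → y ∈ O → x ∈ O) ∧
      ∀ x ∈ O, ∀ y ∈ O, cB x = cB y → R x y) :
    IsSmoothFiberBundle cX cB (torusMk k) π := by
  intro b₀
  obtain ⟨v₀, rfl⟩ := hB.surjective b₀
  obtain ⟨O, hOo, hv₀, hOR, hOcB⟩ := hO v₀
  have hT := isOpenQuotientMap_torusMk k
  have hactB : ∀ a v, cB (act a v) = cB v := fun a v => by rw [← hπ, hactX, hπ]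
  have hRB : ∀ v w, R v w → cB v = cB w := fun v w h => by
    obtain ⟨a, ha⟩ := (hcB v v).1 rfl
    rw [hcB]; exact ⟨a, hRt _ _ _ ha h⟩
  have hmove : ∀ v, cB v ∈ cB '' O → ∃ a, act a v ∈ O := by
    rintro v ⟨w, hw, hvw⟩
    obtain ⟨a, ha⟩ := (hcB v w).1 hvw.symm
    exact ⟨a, hOR _ _ ha hw⟩
  have hsrc : ∀ x, π x ∈ cB '' O → ∃ v ∈ O, cX v = x := by
    intro x hx
    obtain ⟨v, rfl⟩ := hX.surjective x
    obtain ⟨a, ha⟩ := hmove v (by rwa [← hπ])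
    exact ⟨_, ha, hactX a v⟩
  classical
  -- The default value `v₀` is never used: `pX` and `pB` are only evaluated over `cB '' O`.
  let pX : X → E := fun x => if h : π x ∈ cB '' O then (hsrc x h).choose else v₀
  have pX_mem : ∀ x, π x ∈ cB '' O → pX x ∈ O ∧ cX (pX x) = x := by
    intro x h
    simp only [pX, dif_pos h]
    exact (hsrc x h).choose_spec
  let pB : B → E := fun x => if h : x ∈ cB '' O then h.choose else v₀
  have pB_mem : ∀ x, x ∈ cB '' O → pB x ∈ O ∧ cB (pB x) = x := by
    intro x h
    simp only [pB, dif_pos h]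
    exact h.choose_spec
  let pT : UnitAddTorus (Fin k) → Fin k → ℝ := fun t => (hT.surjective t).choose
  have pT_spec : ∀ t, torusMk k (pT t) = t := fun t => (hT.surjective t).choose_spec
  let f : X → B × UnitAddTorus (Fin k) := fun x => (π x, torusMk k (lam (pX x)))
  let g : B × UnitAddTorus (Fin k) → X := fun y => cX (mu (pB y.1, pT y.2))
  -- The chosen representative may be replaced by any other one in `O`: the two are `R`-related, and
  -- on an `R`-class `cX` is determined by `lam` modulo `ℤᵏ`.
  have f_eq : ∀ v ∈ O, f (cX v) = (cB v, torusMk k (lam v)) := by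
    intro v hv
    have h := pX_mem (cX v) (by rw [hπ]; exact mem_image_of_mem _ hv)
    refine Prod.ext (hπ v) ?_
    have hR : R (pX (cX v)) v := hOcB _ h.1 _ hv (by rw [← hπ, h.2, hπ])
    exact (hlamX _ _ hR).1 h.2
  have g_eq : ∀ v ∈ O, ∀ t, g (cB v, torusMk k t) = cX (mu (v, t)) := by
    intro v hv t
    have h := pB_mem (cB v) (mem_image_of_mem _ hv)
    have hR : R (pB (cB v)) v := hOcB _ h.1 _ hv h.2
    refine (hlamX _ _ (hRt _ _ _ (hmuR _ _) (hRt _ _ _ hR (hRs _ _ (hmuR _ _))))).2 ?_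
    rw [hmulam, hmulam, pT_spec]
  -- The choice `pX` need not be continuous. A single `a` that moves `x` into `O` also moves nearby
  -- points there, and gives a smooth lift.
  have f_lift : HasSmoothLiftsOn cX (Prod.map cB (torusMk k)) (π ⁻¹' (cB '' O)) f := by
    intro x hx
    rw [mem_preimage, hπ] at hx
    obtain ⟨a, ha⟩ := hmove x hx
    refine ⟨fun y => (y, lam (act a y)),
      (contDiff_id.prodMk (hlam.comp (hact a))).contDiffAt, ?_⟩
    filter_upwards [(hOo.preimage (hact a).continuous).mem_nhds ha] with y hy
    rw [← hactX a y, f_eq _ hy, hactB]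
    rfl
  have g_lift : HasSmoothLiftsOn (Prod.map cB (torusMk k)) cX ((cB '' O) ×ˢ univ) g := by
    rintro ⟨x, t⟩ hx
    obtain ⟨a, ha⟩ := hmove x hx.1
    refine ⟨fun y => mu (act a y.1, y.2),
      (hmu.comp (((hact a).comp contDiff_fst).prodMk contDiff_snd)).contDiffAt, ?_⟩
    filter_upwards [((hOo.preimage (hact a).continuous).preimage continuous_fst).mem_nhds
      (show ((x, t) : E × (Fin k → ℝ)) ∈ _ from ha)] with y hy
    rw [← g_eq _ hy, hactB]
    rfl
  have hBT : IsOpenQuotientMap (Prod.map cB (torusMk k)) := hB.prodMap hT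
  have hπc : Continuous π := by
    rw [hX.isQuotientMap.continuous_iff]
    convert hB.continuous using 1
    exact funext hπ
  have hOB : IsOpen (cB '' O) := hB.isOpenMap _ hOo
  let e : Bundle.Trivialization (UnitAddTorus (Fin k)) π :=
    { toFun := f
      invFun := g
      source := π ⁻¹' (cB '' O)
      target := (cB '' O) ×ˢ univ
      map_source' := fun x hx => ⟨hx, mem_univ _⟩
      map_target' := by
        rintro ⟨_, t⟩ ⟨⟨v, hv, rfl⟩, -⟩
        obtain ⟨t, rfl⟩ := hT.surjective t
        rw [g_eq v hv, mem_preimage, hπ, hRB _ _ (hmuR v t)]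
        exact mem_image_of_mem _ hv
      left_inv' := by
        intro x hx
        obtain ⟨v, hv, rfl⟩ := hsrc x hx
        rw [f_eq v hv, g_eq v hv]
        refine (hlamX _ _ (hmuR _ _)).2 ?_
        rw [hmulam]
      right_inv' := by
        rintro ⟨_, t⟩ ⟨⟨v, hv, rfl⟩, -⟩
        obtain ⟨t, rfl⟩ := hT.surjective t
        rw [g_eq v hv, f_eq _ (hOR _ _ (hmuR v t) hv), hmulam, hRB _ _ (hmuR v t)]
      open_source := hOB.preimage hπc
      open_target := hOB.prod isOpen_univ
      continuousOn_toFun := f_lift.continuousOn hX hBT.continuous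
      continuousOn_invFun := g_lift.continuousOn hBT hX.continuous
      baseSet := cB '' O
      open_baseSet := hOB
      source_eq := rfl
      target_eq := rfl
      proj_toFun := fun _ _ => rfl }
  exact ⟨e, mem_image_of_mem _ hv₀, f_lift.isSmoothMapOn hBT.continuous,
    g_lift.isSmoothMapOn hX.continuous⟩

/-! ### Three-step nilpotent groups in exponential coordinates -/

/-- Exponential coordinates `exp : V → G` on a group whose Lie algebra `V`, with bracket `br`, is
nilpotent of step at most three; the product is given by the Baker-Campbell-Hausdorff formula. -/
structure ExpCoordinates (V G : Type*) [NormedAddCommGroup V] [NormedSpace ℝ V]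
    [Group G] [TopologicalSpace G] where
  br : V →ₗ[ℝ] V →ₗ[ℝ] V
  br_self : ∀ x, br x x = 0
  nil : ∀ x y z w, br (br (br x y) z) w = 0
  jacobi : ∀ x y z, br (br x y) z = br x (br y z) - br y (br x z)
  exp : V ≃ₜ G
  exp_mul_exp : ∀ x y, exp x * exp y = exp (x + y + (1 / 2 : ℝ) • br x y +
    (1 / 12 : ℝ) • br x (br x y) - (1 / 12 : ℝ) • br y (br x y))

namespace ExpCoordinates

variable {V G : Type*} [NormedAddCommGroup V] [NormedSpace ℝ V]
  [Group G] [TopologicalSpace G] (C : ExpCoordinates V G)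

/-- The product in exponential coordinates. -/
def bch (x y : V) : V := x + y + (1 / 2 : ℝ) • C.br x y +
    (1 / 12 : ℝ) • C.br x (C.br x y) - (1 / 12 : ℝ) • C.br y (C.br x y)

/-- The logarithm `G → V`. -/
abbrev log (g : G) : V := C.exp.symm g

theorem br_skew (x y : V) : C.br x y = -C.br y x := by
  have h := C.br_self (x + y)
  simp only [map_add, LinearMap.add_apply, C.br_self, zero_add, add_zero] at h
  exact eq_neg_of_add_eq_zero_right h

theorem exp_mul (x y : V) : C.exp x * C.exp y = C.exp (C.bch x y) := C.exp_mul_exp x y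

theorem log_mul (g h : G) : C.log (g * h) = C.bch (C.log g) (C.log h) := by
  rw [log, Homeomorph.symm_apply_eq, ← C.exp_mul]
  simp

@[simp] theorem exp_log (g : G) : C.exp (C.log g) = g := by simp

@[simp] theorem log_exp (x : V) : C.log (C.exp x) = x := by simp

theorem exp_zero : C.exp 0 = 1 := by
  have h : C.exp 0 * C.exp 0 = C.exp 0 := by rw [exp_mul]; simp [bch]
  simpa using h

theorem log_one : C.log 1 = 0 := by
  rw [log, Homeomorph.symm_apply_eq, exp_zero]

theorem exp_neg (x : V) : C.exp (-x) = (C.exp x)⁻¹ := by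
  refine eq_inv_of_mul_eq_one_left ?_
  rw [exp_mul, ← C.exp_zero]
  simp [bch, C.br_self]

theorem log_inv (g : G) : C.log g⁻¹ = -C.log g := by
  rw [log, Homeomorph.symm_apply_eq, exp_neg]
  simp

theorem br_eq_zero_of_nil (x y z w : V) : C.br w (C.br z (C.br x y)) = 0 := by
  rw [C.br_skew z, map_neg, C.br_skew w, C.nil, neg_zero, neg_zero]

theorem br_br_br_left (x y z w : V) : C.br (C.br z (C.br x y)) w = 0 := by
  rw [C.br_skew, br_eq_zero_of_nil, neg_zero]

/-- Conjugation in exponential coordinates. -/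
theorem exp_conj (x y : V) : C.exp x * C.exp y * (C.exp x)⁻¹ =
    C.exp (y + C.br x y + (1 / 2 : ℝ) • C.br x (C.br x y)) := by
  rw [mul_inv_eq_iff_eq_mul, exp_mul, exp_mul]
  congr 1
  simp only [bch, map_add, map_smul, LinearMap.add_apply, LinearMap.smul_apply,
    C.br_eq_zero_of_nil, C.br_br_br_left, C.br_self, C.br_skew y x, map_neg,
    C.br_skew (C.br x y) x, smul_zero, add_zero, neg_zero, smul_neg]
  module

/-- Commutators in exponential coordinates. -/
theorem log_commutator (g h : G) : C.log ⁅g, h⁆ = C.br (C.log g) (C.log h) +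
    (1 / 2 : ℝ) • (C.br (C.log g) (C.br (C.log g) (C.log h)) +
      C.br (C.log h) (C.br (C.log g) (C.log h))) := by
  rw [log, Homeomorph.symm_apply_eq]
  obtain ⟨x, rfl⟩ := C.exp.surjective g
  obtain ⟨y, rfl⟩ := C.exp.surjective h
  rw [commutatorElement_def, exp_conj, ← exp_neg, exp_mul]
  simp only [Homeomorph.symm_apply_apply]
  congr 1
  simp only [bch, map_add, map_smul, LinearMap.add_apply, LinearMap.smul_apply,
    C.br_eq_zero_of_nil, C.br_br_br_left, C.br_self, map_neg,
    C.br_skew (C.br x y) y, LinearMap.neg_apply, smul_zero, add_zero, neg_zero, smul_neg,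
    map_zero]
  module

/-! #### Ideals -/

/-- The subspace `I` is an ideal. -/
def IsIdeal (I : Submodule ℝ V) : Prop := ∀ x, ∀ y ∈ I, C.br x y ∈ I

variable {C} {I J : Submodule ℝ V}

theorem IsIdeal.br_mem_left (hI : C.IsIdeal I) {x : V} (hx : x ∈ I) (y : V) : C.br x y ∈ I := by
  rw [C.br_skew]
  exact I.neg_mem (hI y x hx)

theorem isIdeal_bot : C.IsIdeal ⊥ := by
  intro x y hy
  rw [Submodule.mem_bot] at hy ⊢
  rw [hy, map_zero]

theorem isIdeal_top : C.IsIdeal ⊤ := fun _ _ _ => Submodule.mem_top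

/-- Every term of the difference contains a bracket with `a = x - x'`, or is `a` itself. This makes
the group law descend to `V / I`. -/
theorem IsIdeal.bch_sub_bch_mem (hI : C.IsIdeal I) {x x' : V} (h : x - x' ∈ I) (y : V) :
    C.bch x y - C.bch x' y ∈ I := by
  obtain ⟨a, ha, rfl⟩ : ∃ a ∈ I, x = x' + a := ⟨x - x', h, by abel⟩
  have h1 := hI.br_mem_left ha
  have h2 := fun z => hI z _ (h1 y)
  have h3 : C.bch (x' + a) y - C.bch x' y = a + (1 / 2 : ℝ) • C.br a y +
      (1 / 12 : ℝ) • (C.br x' (C.br a y) + C.br a (C.br x' y + C.br a y)) -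
      (1 / 12 : ℝ) • C.br y (C.br a y) := by
    simp only [bch, map_add, LinearMap.add_apply]
    module
  rw [h3]
  exact I.sub_mem (I.add_mem (I.add_mem ha (I.smul_mem _ (h1 y)))
    (I.smul_mem _ (I.add_mem (h2 _) (h1 _)))) (I.smul_mem _ (h2 _))

/-- In the chart the cosets of `exp I` are the affine translates of `I`, so congruence modulo the
subgroup is linear congruence. -/
theorem IsIdeal.log_mul_inv_mem_iff (hI : C.IsIdeal I) (g h : G) :
    C.log (g * h⁻¹) ∈ I ↔ C.log g - C.log h ∈ I := by
  constructor
  · intro hm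
    have h1 := hI.bch_sub_bch_mem (x := C.log (g * h⁻¹)) (x' := C.log 1)
      (by simpa [log_one] using hm) (C.log h)
    rwa [← C.log_mul, ← C.log_mul, inv_mul_cancel_right, one_mul] at h1
  · intro hm
    have h1 := hI.bch_sub_bch_mem hm (C.log h⁻¹)
    rwa [← C.log_mul, ← C.log_mul, mul_inv_cancel, log_one, sub_zero] at h1

/-- The normal subgroup `exp I`. -/
def IsIdeal.subgroup (hI : C.IsIdeal I) : Subgroup G where
  carrier := {g | C.log g ∈ I}
  one_mem' := by simp [C.log_one]
  mul_mem' := by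
    intro a b ha hb
    have := (hI.log_mul_inv_mem_iff a b⁻¹).2 (I.sub_mem ha (by rw [C.log_inv]; exact I.neg_mem hb))
    rwa [inv_inv] at this
  inv_mem' := by
    intro a ha
    simp only [mem_ofPred_eq, C.log_inv] at ha ⊢
    exact I.neg_mem ha

theorem IsIdeal.mem_subgroup (hI : C.IsIdeal I) {g : G} : g ∈ hI.subgroup ↔ C.log g ∈ I := Iff.rfl

theorem IsIdeal.exp_mem_subgroup (hI : C.IsIdeal I) {x : V} : C.exp x ∈ hI.subgroup ↔ x ∈ I := by
  rw [mem_subgroup, log_exp]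

theorem IsIdeal.normal (hI : C.IsIdeal I) : hI.subgroup.Normal where
  conj_mem := by
    intro g hg h
    obtain ⟨x, rfl⟩ := C.exp.surjective g
    obtain ⟨y, rfl⟩ := C.exp.surjective h
    rw [hI.exp_mem_subgroup] at hg
    rw [C.exp_conj, hI.exp_mem_subgroup]
    exact I.add_mem (I.add_mem hg (hI _ _ hg)) (I.smul_mem _ (hI _ _ (hI _ _ hg)))

/-- If `[I, I] ⊆ J`, the logarithm is a homomorphism from `exp I` to `I / J`. -/
theorem IsIdeal.log_mul_sub_mem (hJ : C.IsIdeal J) (hIJ : ∀ x ∈ I, ∀ y ∈ I, C.br x y ∈ J)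
    {g h : G} (hg : C.log g ∈ I) (hh : C.log h ∈ I) :
    C.log (g * h) - (C.log g + C.log h) ∈ J := by
  rw [C.log_mul]
  have h1 := hIJ _ hg _ hh
  have h3 : C.bch (C.log g) (C.log h) - (C.log g + C.log h) =
      (1 / 2 : ℝ) • C.br (C.log g) (C.log h) +
      (1 / 12 : ℝ) • C.br (C.log g) (C.br (C.log g) (C.log h)) -
      (1 / 12 : ℝ) • C.br (C.log h) (C.br (C.log g) (C.log h)) := by
    simp only [bch]; abel
  rw [h3]
  exact J.sub_mem (J.add_mem (J.smul_mem _ h1) (J.smul_mem _ (hJ _ _ h1)))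
    (J.smul_mem _ (hJ _ _ h1))

/-! #### The lower central series -/

variable (C)

/-- The derived ideal `[V, V]`. -/
def derived : Submodule ℝ V := Submodule.span ℝ (range fun p : V × V => C.br p.1 p.2)

/-- The ideal `[[V, V], V]`. -/
def derivedThree : Submodule ℝ V :=
  Submodule.span ℝ (range fun p : V × V × V => C.br (C.br p.1 p.2.1) p.2.2)

theorem br_mem_derived (x y : V) : C.br x y ∈ C.derived := Submodule.subset_span ⟨(x, y), rfl⟩

theorem derivedThree_le_derived : C.derivedThree ≤ C.derived := by
  refine Submodule.span_le.2 ?_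
  rintro _ ⟨p, rfl⟩
  exact C.br_mem_derived _ _

theorem br_mem_derivedThree {x : V} (hx : x ∈ C.derived) (y : V) : C.br x y ∈ C.derivedThree := by
  have : C.derived ≤ C.derivedThree.comap (C.br.flip y) := by
    refine Submodule.span_le.2 ?_
    rintro _ ⟨p, rfl⟩
    exact Submodule.subset_span ⟨(p.1, p.2, y), rfl⟩
  exact this hx

theorem br_mem_derivedThree' (x : V) {y : V} (hy : y ∈ C.derived) : C.br x y ∈ C.derivedThree := by
  rw [C.br_skew]
  exact C.derivedThree.neg_mem (C.br_mem_derivedThree hy x)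

theorem br_eq_zero_of_mem_derivedThree {x : V} (hx : x ∈ C.derivedThree) (y : V) :
    C.br x y = 0 := by
  have : C.derivedThree ≤ LinearMap.ker (C.br.flip y) := by
    refine Submodule.span_le.2 ?_
    rintro _ ⟨p, rfl⟩
    exact C.nil _ _ _ _
  exact this hx

/-- By the Jacobi identity `[x, [a, b]] = [[x, a], b] + [a, [x, b]]`, and for `x` in the derived
ideal both terms are four-fold brackets. -/
theorem br_eq_zero_of_mem_derived {x y : V} (hx : x ∈ C.derived) (hy : y ∈ C.derived) :
    C.br x y = 0 := by
  have : C.derived ≤ LinearMap.ker (C.br x) := by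
    refine Submodule.span_le.2 ?_
    rintro _ ⟨p, rfl⟩
    have h1 := C.jacobi p.1 p.2 x
    have h2 : C.br (C.br x p.1) p.2 = C.br x (C.br p.1 p.2) - C.br p.1 (C.br x p.2) :=
      C.jacobi _ _ _
    have h3 : ∀ z w, C.br (C.br x z) w = 0 := fun z w =>
      C.br_eq_zero_of_mem_derivedThree (C.br_mem_derivedThree hx z) w
    have h4 : ∀ z w, C.br w (C.br x z) = 0 := fun z w => by rw [C.br_skew, h3, neg_zero]
    rw [h3, h4, sub_zero] at h2
    exact h2.symm
  exact this hy

theorem isIdeal_derived : C.IsIdeal C.derived := fun x y _ => C.br_mem_derived x y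

theorem isIdeal_derivedThree : C.IsIdeal C.derivedThree := fun x _ hy =>
  C.br_mem_derivedThree' x (C.derivedThree_le_derived hy)

theorem log_commutator_mem_derived (g h : G) : C.log ⁅g, h⁆ ∈ C.derived := by
  rw [C.log_commutator]
  exact C.derived.add_mem (C.br_mem_derived _ _)
    (C.derived.smul_mem _ (C.derived.add_mem (C.br_mem_derived _ _) (C.br_mem_derived _ _)))

theorem log_commutator_sub_mem_derivedThree (g h : G) :
    C.log ⁅g, h⁆ - C.br (C.log g) (C.log h) ∈ C.derivedThree := by
  rw [C.log_commutator, add_sub_cancel_left]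
  exact C.derivedThree.smul_mem _ (C.derivedThree.add_mem
    (C.br_mem_derivedThree' _ (C.br_mem_derived _ _))
    (C.br_mem_derivedThree' _ (C.br_mem_derived _ _)))

theorem log_commutator_of_mem_derived {g : G} (hg : C.log g ∈ C.derived) (h : G) :
    C.log ⁅g, h⁆ = C.br (C.log g) (C.log h) := by
  have h1 := C.br_mem_derivedThree hg (C.log h)
  have h2 : ∀ z, C.br z (C.br (C.log g) (C.log h)) = 0 := fun z => by
    rw [C.br_skew, C.br_eq_zero_of_mem_derivedThree h1, neg_zero]
  rw [C.log_commutator, h2, h2]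
  simp

theorem log_mul_of_mem_derived {g h : G} (hg : C.log g ∈ C.derived) (hh : C.log h ∈ C.derived) :
    C.log (g * h) = C.log g + C.log h := by
  have := isIdeal_bot.log_mul_sub_mem (C := C) (I := C.derived)
    (fun x hx y hy => by simp [C.br_eq_zero_of_mem_derived hx hy]) hg hh
  simpa [sub_eq_zero] using this

theorem exp_add_of_mem_derived {x y : V} (hx : x ∈ C.derived) (hy : y ∈ C.derived) :
    C.exp (x + y) = C.exp x * C.exp y := by
  rw [← C.log_exp x] at hx
  rw [← C.log_exp y] at hy
  rw [← C.exp_log (C.exp x * C.exp y), C.log_mul_of_mem_derived hx hy]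
  simp

/-- A double commutator is exactly the exponential of the double bracket, all corrections being
four-fold brackets; sums become products because the derived ideal is abelian. -/
theorem derivedThree_subgroup_le : C.isIdeal_derivedThree.subgroup ≤
    (⊤ : Subgroup G).lowerCentralSeries 2 := by
  intro g hg
  obtain ⟨x, rfl⟩ := C.exp.surjective g
  rw [IsIdeal.exp_mem_subgroup] at hg
  have hle := C.derivedThree_le_derived
  have hbase : ∀ x y z, C.exp (C.br (C.br x y) z) ∈ (⊤ : Subgroup G).lowerCentralSeries 2 := by
    intro x y z
    have h1 : ⁅⁅C.exp x, C.exp y⁆, C.exp z⁆ ∈ (⊤ : Subgroup G).lowerCentralSeries 2 :=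
      Subgroup.commutator_mem_commutator (Subgroup.commutator_mem_commutator (Subgroup.mem_top _)
        (Subgroup.mem_top _)) (Subgroup.mem_top _)
    have h2 := C.log_commutator_of_mem_derived (C.log_commutator_mem_derived (C.exp x) (C.exp y))
      (C.exp z)
    rw [log_exp] at h2
    have h3 := C.log_commutator_sub_mem_derivedThree (C.exp x) (C.exp y)
    have h4 := C.br_eq_zero_of_mem_derivedThree h3 z
    rw [map_sub, LinearMap.sub_apply, sub_eq_zero] at h4
    rw [h4, log_exp, log_exp] at h2
    rwa [← h2, exp_log]
  -- The induction carries all real multiples `t • x`, since a subgroup is not known beforehand to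
  -- be stable under scaling in the chart.
  refine (Submodule.span_induction (p := fun x _ => x ∈ C.derived ∧ ∀ t : ℝ, C.exp (t • x) ∈
    (⊤ : Subgroup G).lowerCentralSeries 2) ?_ ?_ ?_ ?_ hg).2 1 |> (by simpa using ·)
  · rintro _ ⟨p, rfl⟩
    refine ⟨C.br_mem_derived _ _, fun t => ?_⟩
    rw [← map_smul]
    exact hbase _ _ _
  · simp [C.exp_zero]
  · rintro x y - - ⟨hx, hx'⟩ ⟨hy, hy'⟩
    refine ⟨C.derived.add_mem hx hy, fun t => ?_⟩
    rw [smul_add, C.exp_add_of_mem_derived (C.derived.smul_mem _ hx) (C.derived.smul_mem _ hy)]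
    exact Subgroup.mul_mem _ (hx' t) (hy' t)
  · rintro a x - ⟨hx, hx'⟩
    refine ⟨C.derived.smul_mem _ hx, fun t => ?_⟩
    rw [smul_smul]
    exact hx' _

/-- A commutator agrees with the exponential of the bracket only up to `exp derivedThree`. That
error already lies in the third term of the series, hence in the second. -/
theorem lowerCentralSeries_one_eq :
    (⊤ : Subgroup G).lowerCentralSeries 1 = C.isIdeal_derived.subgroup := by
  refine le_antisymm ?_ ?_
  · refine Subgroup.commutator_le.2 fun g _ h _ => C.log_commutator_mem_derived g h
  · intro g hg
    obtain ⟨x, rfl⟩ := C.exp.surjective g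
    rw [IsIdeal.exp_mem_subgroup] at hg
    refine (Submodule.span_induction (p := fun x _ => x ∈ C.derived ∧ ∀ t : ℝ, C.exp (t • x) ∈
      (⊤ : Subgroup G).lowerCentralSeries 1) ?_ ?_ ?_ ?_ hg).2 1 |> (by simpa using ·)
    · rintro _ ⟨p, rfl⟩
      refine ⟨C.br_mem_derived _ _, fun t => ?_⟩
      rw [← map_smul]
      generalize t • p.2 = y
      have h1 : ⁅C.exp p.1, C.exp y⁆ ∈ (⊤ : Subgroup G).lowerCentralSeries 1 :=
        Subgroup.commutator_mem_commutator (Subgroup.mem_top _) (Subgroup.mem_top _)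
      have h2 := C.log_commutator_sub_mem_derivedThree (C.exp p.1) (C.exp y)
      rw [log_exp, log_exp] at h2
      have h3 : C.br p.1 y = -(C.log ⁅C.exp p.1, C.exp y⁆ - C.br p.1 y) +
        C.log ⁅C.exp p.1, C.exp y⁆ := by abel
      have h2' := C.derivedThree.neg_mem h2
      rw [h3, C.exp_add_of_mem_derived (C.derivedThree_le_derived h2')
        (C.log_commutator_mem_derived _ _), exp_log]
      exact Subgroup.mul_mem _ (Subgroup.lowerCentralSeries_antitone _ one_le_two
        (C.derivedThree_subgroup_le (IsIdeal.exp_mem_subgroup _ |>.2 h2'))) h1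
    · simp [C.exp_zero]
    · rintro x y - - ⟨hx, hx'⟩ ⟨hy, hy'⟩
      refine ⟨C.derived.add_mem hx hy, fun t => ?_⟩
      rw [smul_add, C.exp_add_of_mem_derived (C.derived.smul_mem _ hx) (C.derived.smul_mem _ hy)]
      exact Subgroup.mul_mem _ (hx' t) (hy' t)
    · rintro a x - ⟨hx, hx'⟩
      refine ⟨C.derived.smul_mem _ hx, fun t => ?_⟩
      rw [smul_smul]
      exact hx' _

theorem lowerCentralSeries_two_eq :
    (⊤ : Subgroup G).lowerCentralSeries 2 = C.isIdeal_derivedThree.subgroup := by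
  refine le_antisymm ?_ C.derivedThree_subgroup_le
  refine Subgroup.commutator_le.2 fun g hg h _ => ?_
  rw [C.lowerCentralSeries_one_eq] at hg
  rw [IsIdeal.mem_subgroup, C.log_commutator_of_mem_derived hg]
  exact C.br_mem_derivedThree hg _

end ExpCoordinates

namespace ExpCoordinates

variable {V G : Type*} [NormedAddCommGroup V] [NormedSpace ℝ V]
  [Group G] [TopologicalSpace G] {C : ExpCoordinates V G}

/-! ### Lattices -/

/-- The logarithms of the elements of `Γ ∩ exp I`. -/
def logSet (C : ExpCoordinates V G) (Γ : Subgroup G) (I : Submodule ℝ V) : Set V :=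
  {x | x ∈ I ∧ C.exp x ∈ Γ}

variable {Γ : Subgroup G} {I J : Submodule ℝ V}

theorem log_mem_logSet {g : G} (hg : g ∈ Γ) (h : C.log g ∈ I) : C.log g ∈ C.logSet Γ I :=
  ⟨h, by rwa [exp_log]⟩

open MeasureTheory in
/-- A continuous homomorphism to `ℝ` that is trivial on a lattice is not surjective. -/
theorem not_surjective_of_isLattice (hΓ : IsLattice Γ) (F : G → ℝ) (hF : Continuous F)
    (hmul : ∀ g h, F (g * h) = F g + F h) (hker : ∀ g ∈ Γ, F g = 0) :
    ¬ Function.Surjective F := by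
  intro hsurj
  obtain ⟨ν, hν0, hνtop, hinv⟩ := hΓ.finite_covolume
  let _ : MeasurableSpace (CosetSpace Γ) := borel _
  have : BorelSpace (CosetSpace Γ) := ⟨rfl⟩
  let f : CosetSpace Γ → ℝ := Quotient.lift F fun x y hxy => by
    have h1 := hker _ (QuotientGroup.rightRel_apply.1 hxy)
    have h2 := hmul (y * x⁻¹) x
    rw [h1, inv_mul_cancel_right, zero_add] at h2
    exact h2.symm
  have hf : Continuous f := hF.quotient_lift _
  have hfm : Measurable f := hf.measurable
  -- Surjectivity of `F` makes the pushforward invariant under all translations of `ℝ`; such a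
  -- measure, if nonzero, has infinite total mass.
  let μ : Measure ℝ := ν.map f
  have hμ : μ univ = ν univ := by rw [Measure.map_apply hfm MeasurableSet.univ, preimage_univ]
  have : IsFiniteMeasure μ := ⟨by rw [hμ]; exact hνtop⟩
  have : NeZero μ := ⟨fun h => hν0 (by rw [← hμ, h]; rfl)⟩
  have : μ.IsAddLeftInvariant := by
    refine ⟨fun c => ?_⟩
    obtain ⟨g, rfl⟩ := hsurj c
    ext A hA
    rw [Measure.map_apply (measurable_const_add _) hA, Measure.map_apply hfm hA,
      Measure.map_apply hfm (measurable_const_add _ hA), ← hinv g _ (hfm hA)]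
    congr 1
    ext x
    obtain ⟨x, rfl⟩ := Quotient.exists_rep x
    change F g + F x ∈ A ↔ F (x * g) ∈ A
    rw [hmul, add_comm]
  exact (measure_lt_top μ univ).ne (measure_univ_of_isAddLeftInvariant μ)

/-- A nonzero functional vanishing on `log Γ` and on the derived ideal would give a surjective
homomorphism to `ℝ` that is trivial on `Γ`. -/
theorem span_logSet_top_sup_derived [FiniteDimensional ℝ V] (hΓ : IsLattice Γ) :
    Submodule.span ℝ (C.logSet Γ ⊤) ⊔ C.derived = ⊤ := by
  by_contra hne
  obtain ⟨f, hf0, hf⟩ := Submodule.exists_le_ker_of_lt_top _ (lt_top_iff_ne_top.2 hne)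
  refine not_surjective_of_isLattice hΓ (fun g => f (C.log g))
    ((LinearMap.continuous_of_finiteDimensional f).comp C.exp.symm.continuous) ?_ ?_ ?_
  · intro g h
    have h1 := C.isIdeal_derived.log_mul_sub_mem (I := ⊤)
      (fun x _ y _ => C.br_mem_derived x y) (g := g) (h := h) Submodule.mem_top Submodule.mem_top
    have h2 : f _ = 0 := (le_sup_right.trans hf) h1
    rwa [map_sub, map_add, sub_eq_zero] at h2
  · intro g hg
    exact (le_sup_left.trans hf) (Submodule.subset_span (log_mem_logSet hg Submodule.mem_top))
  · exact (LinearMap.surjective hf0).comp C.exp.symm.surjective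

/-! ### Lattice elements spanning the terms of the lower central series -/

section Span

variable (hspan : Submodule.span ℝ (C.logSet Γ ⊤) ⊔ C.derived = ⊤)
include hspan

theorem mem_of_logSet_of_derived {M : Submodule ℝ V} (h : ∀ g ∈ Γ, C.log g ∈ M)
    (h' : C.derived ≤ M) (x : V) : x ∈ M := by
  have : (⊤ : Submodule ℝ V) ≤ M := by
    rw [← hspan]
    refine sup_le (Submodule.span_le.2 fun x hx => ?_) h'
    rw [← C.log_exp x]
    exact h _ hx.2
  exact this Submodule.mem_top

/-- The triple bracket vanishes as soon as one argument lies in the derived ideal, so it suffices to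
take all three arguments in `log Γ`, where it is the logarithm of a double commutator in `Γ`. The
arguments are replaced one at a time. -/
theorem derivedThree_le_span_logSet :
    C.derivedThree ≤ Submodule.span ℝ (C.logSet Γ C.derivedThree) := by
  refine Submodule.span_le.2 ?_
  rintro _ ⟨⟨x, y, z⟩, rfl⟩
  have h0 : ∀ {x y z}, C.br (C.br x y) z = 0 →
      C.br (C.br x y) z ∈ Submodule.span ℝ (C.logSet Γ C.derivedThree) :=
    fun h => by rw [h]; exact Submodule.zero_mem _
  refine mem_of_logSet_of_derived hspan (M := (Submodule.span ℝ (C.logSet Γ C.derivedThree)).comap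
    (C.br (C.br x y))) (fun c hc => ?_) (fun c hc => h0 ?_) z
  · refine mem_of_logSet_of_derived hspan (M := (Submodule.span ℝ
      (C.logSet Γ C.derivedThree)).comap ((C.br.flip (C.log c)).comp (C.br x)))
      (fun b hb => ?_) (fun b hb => h0 ?_) y
    · refine mem_of_logSet_of_derived hspan (M := (Submodule.span ℝ
        (C.logSet Γ C.derivedThree)).comap ((C.br.flip (C.log c)).comp (C.br.flip (C.log b))))
        (fun a ha => ?_) (fun a ha => h0 ?_) x
      · have h1 := C.log_commutator_mem_derived a b
        have h2 := C.log_commutator_of_mem_derived h1 c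
        have h3 := C.br_eq_zero_of_mem_derivedThree
          (C.log_commutator_sub_mem_derivedThree a b) (C.log c)
        rw [map_sub, LinearMap.sub_apply, sub_eq_zero] at h3
        have h4 : ∀ {g h : G}, g ∈ Γ → h ∈ Γ → ⁅g, h⁆ ∈ Γ := fun hg hh =>
          Γ.mul_mem (Γ.mul_mem (Γ.mul_mem hg hh) (Γ.inv_mem hg)) (Γ.inv_mem hh)
        refine Submodule.subset_span ?_
        change C.br (C.br (C.log a) (C.log b)) (C.log c) ∈ _
        rw [← h3, ← h2]
        refine log_mem_logSet (h4 (h4 ha hb) hc) ?_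
        rw [h2]
        exact C.br_mem_derivedThree h1 _
      · exact C.br_eq_zero_of_mem_derivedThree (C.br_mem_derivedThree ha _) _
    · exact C.br_eq_zero_of_mem_derivedThree (C.br_mem_derivedThree' _ hb) _
  · exact C.br_eq_zero_of_mem_derived (C.br_mem_derived _ _) hc

/-- The same replacement of arguments works modulo `derivedThree`, which is already spanned; the
bracket of two logarithms differs from the logarithm of the commutator by an element of it. -/
theorem derived_le_span_logSet :
    C.derived ≤ Submodule.span ℝ (C.logSet Γ C.derived) := by
  have h3 : C.derivedThree ≤ Submodule.span ℝ (C.logSet Γ C.derived) :=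
    (derivedThree_le_span_logSet hspan).trans
      (Submodule.span_mono fun x hx => ⟨C.derivedThree_le_derived hx.1, hx.2⟩)
  refine Submodule.span_le.2 ?_
  rintro _ ⟨⟨x, y⟩, rfl⟩
  refine mem_of_logSet_of_derived hspan (M := (Submodule.span ℝ (C.logSet Γ C.derived)).comap
    (C.br x)) (fun b hb => ?_) (fun b hb => h3 (C.br_mem_derivedThree' _ hb)) y
  refine mem_of_logSet_of_derived hspan (M := (Submodule.span ℝ (C.logSet Γ C.derived)).comap
    (C.br.flip (C.log b))) (fun a ha => ?_) (fun a ha => h3 (C.br_mem_derivedThree ha _)) x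
  have h4 : ⁅a, b⁆ ∈ Γ := Γ.mul_mem (Γ.mul_mem (Γ.mul_mem ha hb) (Γ.inv_mem ha)) (Γ.inv_mem hb)
  have h5 := Submodule.sub_mem _ (Submodule.subset_span (R := ℝ)
    (log_mem_logSet h4 (C.log_commutator_mem_derived a b)))
    (h3 (C.log_commutator_sub_mem_derivedThree a b))
  rwa [sub_sub_cancel] at h5

end Span

/-! ### Lattice coordinates -/

/-- The image of `Γ` modulo `exp I` is discrete. -/
def DiscreteModulo (C : ExpCoordinates V G) (Γ : Subgroup G) (I : Submodule ℝ V) : Prop :=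
  ∃ O ∈ 𝓝 (1 : G), ∀ g ∈ Γ, ∀ a ∈ O, C.log (g * a⁻¹) ∈ I → C.log g ∈ I

theorem discreteModulo_bot [DiscreteTopology Γ] : C.DiscreteModulo Γ ⊥ := by
  have h : ({1} : Set Γ) ∈ 𝓝 (1 : Γ) := by rw [nhds_discrete]; exact mem_pure.2 rfl
  rw [nhds_subtype, mem_comap] at h
  obtain ⟨O, hO, hO1⟩ := h
  refine ⟨O, hO, fun g hg a ha h => ?_⟩
  rw [Submodule.mem_bot, ← C.log_one, C.exp.symm.injective.eq_iff, mul_inv_eq_one] at h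
  have h1 : (⟨g, hg⟩ : Γ) ∈ ({1} : Set Γ) := hO1 (show g ∈ O by rwa [h])
  have h2 : g = 1 := congrArg Subtype.val (mem_singleton_iff.1 h1)
  rw [h2, C.log_one]
  exact Submodule.zero_mem _

/-- Linear coordinates on `I / J` in which the image of `Γ ∩ exp I` is `ℤᵏ`. -/
structure LatticeCoordinates (C : ExpCoordinates V G) (Γ : Subgroup G) (J I : Submodule ℝ V)
    (k : ℕ) where
  coord : V →ₗ[ℝ] Fin k → ℝ
  lift : (Fin k → ℝ) →ₗ[ℝ] V
  lift_mem : ∀ t, lift t ∈ I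
  coord_lift : ∀ t, coord (lift t) = t
  coord_eq_zero_iff : ∀ x ∈ I, coord x = 0 ↔ x ∈ J
  coord_log : ∀ g ∈ Γ, C.log g ∈ I → ∃ m : Fin k → ℤ, coord (C.log g) = fun i => (m i : ℝ)
  exists_coord_log : ∀ m : Fin k → ℤ, ∃ g ∈ Γ, C.log g ∈ I ∧ coord (C.log g) = fun i => (m i : ℝ)

theorem exists_linear_coordinates [FiniteDimensional ℝ V] (hJI : J ≤ I) {k : ℕ}
    (hk : Module.finrank ℝ J + k = Module.finrank ℝ I) :
    ∃ (T : V →ₗ[ℝ] Fin k → ℝ) (S : (Fin k → ℝ) →ₗ[ℝ] V), (∀ t, S t ∈ I) ∧ (∀ t, T (S t) = t) ∧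
      ∀ x ∈ I, T x = 0 ↔ x ∈ J := by
  let J' : Submodule ℝ I := J.comap I.subtype
  have h1 : Module.finrank ℝ J' = Module.finrank ℝ J :=
    (Submodule.comapSubtypeEquivOfLe hJI).finrank_eq
  have h2 : Module.finrank ℝ (I ⧸ J') = k := by
    have := J'.finrank_quotient_add_finrank
    omega
  let e : (I ⧸ J') ≃ₗ[ℝ] (Fin k → ℝ) := LinearEquiv.ofFinrankEq _ _ (by rw [h2]; simp)
  let T₀ : I →ₗ[ℝ] Fin k → ℝ := e.toLinearMap ∘ₗ J'.mkQ
  obtain ⟨T, hT⟩ := T₀.exists_extend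
  have hT' : ∀ x : I, T x = T₀ x := fun x => by rw [← hT]; rfl
  have hsurj : LinearMap.range T₀ = ⊤ :=
    LinearMap.range_eq_top.2 (e.surjective.comp J'.mkQ_surjective)
  obtain ⟨S, hS⟩ := T₀.exists_rightInverse_of_surjective hsurj
  refine ⟨T, I.subtype ∘ₗ S, fun t => (S t).2, fun t => ?_, fun x hx => ?_⟩
  · have := LinearMap.congr_fun hS t
    simpa [hT'] using this
  · rw [hT' ⟨x, hx⟩]
    simp [T₀, J']

/-- Since `[I, I] ⊆ J`, the logarithm maps `Γ ∩ exp I` homomorphically to `I / J`. Its image is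
discrete by `hd` and spanning by `hs`, so a `ℤ`-basis of it is a real basis of `I / J`. -/
theorem nonempty_latticeCoordinates [FiniteDimensional ℝ V] (hJ : C.IsIdeal J) (hI : C.IsIdeal I)
    (hJI : J ≤ I) (hIJ : ∀ x ∈ I, ∀ y ∈ I, C.br x y ∈ J) (hd : C.DiscreteModulo Γ J)
    (hs : I ≤ Submodule.span ℝ (C.logSet Γ I) ⊔ J) {k : ℕ}
    (hk : Module.finrank ℝ J + k = Module.finrank ℝ I) :
    Nonempty (LatticeCoordinates C Γ J I k) := by
  obtain ⟨T, S, hSI, hTS, hT0⟩ := exists_linear_coordinates hJI hk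
  have hTmul : ∀ g h, C.log g ∈ I → C.log h ∈ I →
      T (C.log (g * h)) = T (C.log g) + T (C.log h) := by
    intro g h hg hh
    have h1 := hJ.log_mul_sub_mem hIJ hg hh
    have h2 := (hT0 _ (hJI h1)).2 h1
    rwa [map_sub, map_add, sub_eq_zero] at h2
  let L : AddSubgroup (Fin k → ℝ) :=
    { carrier := {t | ∃ g ∈ Γ, C.log g ∈ I ∧ T (C.log g) = t}
      zero_mem' := ⟨1, Γ.one_mem, by simp [C.log_one], by simp [C.log_one]⟩
      add_mem' := by
        rintro _ _ ⟨g, hg, hgI, rfl⟩ ⟨h, hh, hhI, rfl⟩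
        exact ⟨g * h, Γ.mul_mem hg hh, hI.subgroup.mul_mem hgI hhI, hTmul g h hgI hhI⟩
      neg_mem' := by
        rintro _ ⟨g, hg, hgI, rfl⟩
        exact ⟨g⁻¹, Γ.inv_mem hg, hI.subgroup.inv_mem hgI, by rw [C.log_inv, map_neg]⟩ }
  let Λ : Submodule ℤ (Fin k → ℝ) := L.toIntSubmodule
  have : DiscreteTopology Λ := by
    obtain ⟨O, hO, hdisc⟩ := hd
    have hcont : Continuous fun t => C.exp (S t) :=
      C.exp.continuous.comp (LinearMap.continuous_of_finiteDimensional S)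
    have hO' : (fun t => C.exp (S t)) ⁻¹' O ∈ 𝓝 (0 : Fin k → ℝ) :=
      hcont.continuousAt (by rwa [map_zero, C.exp_zero])
    have hz : ∀ t ∈ L, C.exp (S t) ∈ O → t = 0 := by
      rintro _ ⟨g, hg, hgI, rfl⟩ hO
      refine (hT0 _ hgI).2 (hdisc g hg _ hO ?_)
      rw [hJ.log_mul_inv_mem_iff, log_exp, ← hT0 _ (I.sub_mem hgI (hSI _)), map_sub, hTS, sub_self]
    have : DiscreteTopology L := by
      refine discreteTopology_of_isOpen_singleton_zero ?_
      rw [isOpen_iff_mem_nhds]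
      rintro _ rfl
      rw [nhds_subtype, mem_comap]
      exact ⟨_, hO', fun t ht => Subtype.ext (hz t t.2 ht)⟩
    exact this
  have : IsZLattice ℝ Λ := by
    refine ⟨eq_top_iff.2 fun t _ => ?_⟩
    have h1 : Submodule.span ℝ (C.logSet Γ I) ⊔ J ≤
        (Submodule.span ℝ (Λ : Set (Fin k → ℝ))).comap T := by
      refine sup_le (Submodule.span_le.2 ?_) fun x hx => ?_
      · rintro x ⟨hx, hx'⟩
        exact Submodule.subset_span ⟨C.exp x, hx', by simpa using hx, by simp⟩
      · rw [Submodule.mem_comap, (hT0 x (hJI hx)).2 hx]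
        exact Submodule.zero_mem _
    have := h1 (hs (hSI t))
    rwa [Submodule.mem_comap, hTS] at this
  let b := IsZLattice.basis Λ
  let e := (b.ofZLatticeBasis ℝ Λ).equivFun
  have he : ∀ x : Λ, e x = fun i => ((b.repr x i : ℤ) : ℝ) := fun x => by
    ext i
    exact b.ofZLatticeBasis_repr_apply ℝ Λ x i
  refine ⟨{ coord := e.toLinearMap ∘ₗ T, lift := S ∘ₗ e.symm.toLinearMap
            lift_mem := fun t => hSI _, coord_lift := fun t => by simp [hTS]
            coord_eq_zero_iff := fun x hx => by simp [hT0 x hx]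
            coord_log := fun g hg hgI => ⟨_, he ⟨_, g, hg, hgI, rfl⟩⟩
            exists_coord_log := fun m => ?_ }⟩
  let x : Λ := b.equivFun.symm m
  obtain ⟨g, hg, hgI, hgx⟩ := x.2
  refine ⟨g, hg, hgI, ?_⟩
  have h1 := he x
  rw [← hgx] at h1
  simp only [LinearMap.comp_apply, LinearEquiv.coe_coe, h1]
  ext i
  rw [← Module.Basis.equivFun_apply, LinearEquiv.apply_symm_apply]

namespace LatticeCoordinates

variable {k : ℕ} (L : LatticeCoordinates C Γ J I k)

theorem coord_log_mul (hJ : C.IsIdeal J) (hJI : J ≤ I) (hIJ : ∀ x ∈ I, ∀ y ∈ I, C.br x y ∈ J)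
    {g h : G} (hg : C.log g ∈ I) (hh : C.log h ∈ I) :
    L.coord (C.log (g * h)) = L.coord (C.log g) + L.coord (C.log h) := by
  have h1 := hJ.log_mul_sub_mem hIJ hg hh
  have h2 := (L.coord_eq_zero_iff _ (hJI h1)).2 h1
  rwa [map_sub, map_add, sub_eq_zero] at h2

/-- If `Γ ∩ exp I` is cocompact in the abelian group `exp I`, then `Γ` is discrete
modulo `exp I`. -/
theorem discreteModulo [FiniteDimensional ℝ V] [IsTopologicalGroup G] [DiscreteTopology Γ]
    (L : LatticeCoordinates C Γ ⊥ I k) (hI : C.IsIdeal I)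
    (hII : ∀ x ∈ I, ∀ y ∈ I, C.br x y = 0) : C.DiscreteModulo Γ I := by
  have : T2Space G := C.exp.t2Space
  have : LocallyCompactSpace G := C.exp.symm.isClosedEmbedding.locallyCompactSpace
  obtain ⟨B, hBc, hB⟩ := exists_compact_mem_nhds (1 : G)
  let K : Set G := (fun t => C.exp (L.lift t)) '' Icc 0 1
  have hK : IsCompact K := isCompact_Icc.image
    (C.exp.continuous.comp (LinearMap.continuous_of_finiteDimensional L.lift))
  -- The integer parts of the coordinates are realized by an element `c` of `Γ`; the fractional
  -- parts remain in the image `K` of the unit cube.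
  have hmulK : ∀ g, C.log g ∈ I → ∃ c ∈ Γ, C.log c ∈ I ∧ c⁻¹ * g ∈ K := by
    intro g hg
    obtain ⟨c, hc, hcI, hcm⟩ := L.exists_coord_log fun i => ⌊L.coord (C.log g) i⌋
    refine ⟨c, hc, hcI, fun i => Int.fract (L.coord (C.log g) i), ⟨fun i => Int.fract_nonneg _,
      fun i => (Int.fract_lt_one _).le⟩, ?_⟩
    have h1 : C.log (c⁻¹ * g) ∈ I := hI.subgroup.mul_mem (hI.subgroup.inv_mem hcI) hg
    have h2 := L.coord_log_mul isIdeal_bot bot_le (fun x hx y hy => by simp [hII x hx y hy])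
      (hI.subgroup.inv_mem hcI) hg
    rw [C.log_inv, map_neg, hcm] at h2
    rw [← C.exp.apply_symm_apply (c⁻¹ * g)]
    refine congrArg _ (sub_eq_zero.1 ?_)
    have h3 := L.coord_eq_zero_iff _ (I.sub_mem (L.lift_mem
      fun i => Int.fract (L.coord (C.log g) i)) h1)
    rw [Submodule.mem_bot] at h3
    rw [← h3, map_sub, L.coord_lift, h2]
    ext i
    simp only [Pi.add_apply, Pi.sub_apply, Pi.neg_apply, ← Int.self_sub_floor, Pi.zero_apply]
    ring
  -- Only finitely many lattice points can be translated near `exp I` within the compact set `K *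
  -- B`, so one neighbourhood of `1` keeps all those outside the closed set `exp I` from entering
  -- it.
  have hfin : ((Γ : Set G) ∩ (K * B)).Finite := by
    have hclosed : IsClosed (Γ : Set G) := Subgroup.isClosed_of_discrete
    have h1 := (hclosed.isClosedEmbedding_subtypeVal.isCompact_preimage
      (hK.mul hBc)).finite_of_discrete
    rw [← Subtype.image_preimage_coe]
    exact h1.image _
  have hIc : IsClosed {g | C.log g ∈ I} :=
    I.closed_of_finiteDimensional.preimage C.exp.symm.continuous
  have hnear : ∀ s, C.log s ∉ I → ∀ᶠ a in 𝓝 (1 : G), C.log (s * a⁻¹) ∉ I := by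
    intro s hs
    have hc : ContinuousAt (fun a : G => s * a⁻¹) 1 := by fun_prop
    exact hc (by simpa using hIc.isOpen_compl.mem_nhds hs)
  have hall : ∀ᶠ a in 𝓝 (1 : G), ∀ s ∈ (Γ : Set G) ∩ (K * B), C.log s ∉ I →
      C.log (s * a⁻¹) ∉ I := by
    rw [eventually_all_finite hfin]
    intro s _
    by_cases h : C.log s ∈ I
    · exact Eventually.of_forall fun a h' => absurd h h'
    · exact (hnear s h).mono fun a ha _ => ha
  refine ⟨_, inter_mem hB hall, fun g hg a ha hga => ?_⟩
  obtain ⟨c, hc, hcI, hcK⟩ := hmulK _ hga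
  by_contra hgI
  have h1 : C.log (c⁻¹ * g) ∉ I := fun h => hgI (by
    have := hI.subgroup.mul_mem hcI h
    rwa [mul_inv_cancel_left] at this)
  -- Membership in `K * B` comes from `c⁻¹ * g = (c⁻¹ * (g * a⁻¹)) * a`.
  refine ha.2 (c⁻¹ * g) ⟨Γ.mul_mem (Γ.inv_mem hc) hg, _, hcK, a, ha.1, by group⟩ h1 ?_
  rw [mul_assoc]
  exact hI.subgroup.mul_mem (hI.subgroup.inv_mem hcI) hga

end LatticeCoordinates

end ExpCoordinates

/-! ### Descending smooth maps to quotients -/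

/-- Quotients of vector spaces are diffeomorphic if smooth maps between the vector spaces identify
the equivalence relations. -/
theorem isDiffeomorphic_of_smooth_maps {E E' X B : Type*} [NormedAddCommGroup E] [NormedSpace ℝ E]
    [NormedAddCommGroup E'] [NormedSpace ℝ E'] [TopologicalSpace X] [TopologicalSpace B]
    {cX : E → X} {cB : E' → B} (hX : IsOpenQuotientMap cX) (hB : IsOpenQuotientMap cB)
    {Φ : E → E'} {Ψ : E' → E} (hΦ : ContDiff ℝ ∞ Φ) (hΨ : ContDiff ℝ ∞ Ψ)
    (h : ∀ v w, cX v = cX w ↔ cB (Φ v) = cB (Φ w)) (h' : ∀ t, cB (Φ (Ψ t)) = cB t) :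
    IsDiffeomorphic cX cB := by
  let f : X → B := fun x => cB (Φ (hX.surjective x).choose)
  let g : B → X := fun x => cX (Ψ (hB.surjective x).choose)
  have hf : ∀ v, f (cX v) = cB (Φ v) := fun v => (h _ _).1 (hX.surjective (cX v)).choose_spec
  have hg : ∀ t, g (cB t) = cX (Ψ t) := fun t => by
    rw [h, h', h', (hB.surjective (cB t)).choose_spec]
  let φ : X ≃ B :=
    { toFun := f
      invFun := g
      left_inv := fun x => by
        obtain ⟨v, rfl⟩ := hX.surjective x
        rw [hf, hg, h, h']
      right_inv := fun x => by
        obtain ⟨t, rfl⟩ := hB.surjective x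
        rw [hg, hf, h'] }
  exact isDiffeomorphic_of_hasSmoothLiftsOn hX hB φ
    (fun x _ => ⟨Φ, hΦ.contDiffAt, Eventually.of_forall hf⟩)
    (fun x _ => ⟨Ψ, hΨ.contDiffAt, Eventually.of_forall hg⟩)

/-- The map `P` is `V → V / I` followed by a linear section: it picks one representative in each
class modulo `I`. -/
theorem exists_linear_projection {V : Type*} [AddCommGroup V] [Module ℝ V] (I : Submodule ℝ V) :
    ∃ P : V →ₗ[ℝ] V, (∀ x, P x = 0 ↔ x ∈ I) ∧ ∀ x, P x - x ∈ I := by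
  obtain ⟨S, hS⟩ := I.mkQ.exists_rightInverse_of_surjective (Submodule.range_mkQ I)
  have hS' : ∀ x, I.mkQ (S x) = x := fun x => LinearMap.congr_fun hS x
  have hinj : Function.Injective S := Function.LeftInverse.injective hS'
  refine ⟨S ∘ₗ I.mkQ, fun x => ?_, fun x => ?_⟩
  · rw [LinearMap.comp_apply, map_eq_zero_iff S hinj]
    simp
  · refine (Submodule.Quotient.mk_eq_zero I).1 ?_
    change I.mkQ (S (I.mkQ x) - x) = 0
    rw [map_sub, hS', sub_self]

namespace ExpCoordinates

variable {V G : Type*} [NormedAddCommGroup V] [NormedSpace ℝ V]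
  [Group G] [TopologicalSpace G] (C : ExpCoordinates V G)

/-! ### The fibre bundles -/

theorem contDiff_bch [FiniteDimensional ℝ V] {E : Type*} [NormedAddCommGroup E] [NormedSpace ℝ E]
    {f g : E → V} (hf : ContDiff ℝ ∞ f) (hg : ContDiff ℝ ∞ g) :
    ContDiff ℝ ∞ fun x => C.bch (f x) (g x) := by
  let br' : V →L[ℝ] V →L[ℝ] V := LinearMap.toContinuousLinearMap
    ((LinearMap.toContinuousLinearMap : (V →ₗ[ℝ] V) ≃ₗ[ℝ] (V →L[ℝ] V)).toLinearMap ∘ₗ C.br)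
  have hbr : ∀ {f g : E → V}, ContDiff ℝ ∞ f → ContDiff ℝ ∞ g →
      ContDiff ℝ ∞ fun x => C.br (f x) (g x) := fun {f g} hf hg =>
    (br'.contDiff.comp hf).clm_apply hg
  have h1 := hbr hf hg
  exact (((hf.add hg).add (h1.const_smul _)).add ((hbr hf h1).const_smul _)).sub
    ((hbr hg h1).const_smul _)

variable {C} {Γ : Subgroup G} {I J : Submodule ℝ V}

/-- A small neighbourhood of `v`, saturated by the cosets of `exp I`, meets its `Γ`-translates only
trivially modulo `I`, because `Γ` is discrete there. -/
theorem exists_saturated_nhd [IsTopologicalGroup G] {B : Type*} {cB : V → B} (hI : C.IsIdeal I)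
    (hd : C.DiscreteModulo Γ I)
    (hcB : ∀ v w, cB v = cB w ↔ ∃ g ∈ Γ, C.log (g * C.exp v * (C.exp w)⁻¹) ∈ I) (v : V) :
    ∃ O : Set V, IsOpen O ∧ v ∈ O ∧ (∀ x y, x - y ∈ I → y ∈ O → x ∈ O) ∧
      ∀ x ∈ O, ∀ y ∈ O, cB x = cB y → x - y ∈ I := by
  obtain ⟨Ω, hΩ, hdisc⟩ := hd
  obtain ⟨Ω', hΩ', hsplit⟩ := exists_nhds_split_inv hΩ
  have := hI.normal
  let q : G →* G ⧸ hI.subgroup := QuotientGroup.mk' hI.subgroup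
  have hq : IsOpenQuotientMap q := QuotientGroup.isOpenQuotientMap_mk
  have hqI : ∀ g h, q g = q h ↔ C.log g - C.log h ∈ I := fun g h => by
    rw [← hI.log_mul_inv_mem_iff, ← hI.mem_subgroup, ← div_eq_mul_inv]
    exact QuotientGroup.eq_iff_div_mem
  have hqI' : ∀ x y, q (C.exp x) = q (C.exp y) ↔ x - y ∈ I := fun x y => by simp [hqI]
  let S : Set G := (fun a => a * C.exp v) '' interior Ω'
  have hS : IsOpen S := (Homeomorph.mulRight (C.exp v)).isOpenMap _ isOpen_interior
  refine ⟨(fun x => q (C.exp x)) ⁻¹' (q '' S), (hq.isOpenMap _ hS).preimage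
    (hq.continuous.comp C.exp.continuous), ⟨_, ⟨1, mem_interior_iff_mem_nhds.2 hΩ', rfl⟩, by simp⟩,
    fun x y hxy hy => ?_, ?_⟩
  · rw [mem_preimage, (hqI' x y).2 hxy]
    exact hy
  · rintro x ⟨_, ⟨a, ha, rfl⟩, hax⟩ y ⟨_, ⟨b, hb, rfl⟩, hby⟩ hxy
    change q (a * C.exp v) = q (C.exp x) at hax
    change q (b * C.exp v) = q (C.exp y) at hby
    obtain ⟨g, hg, hgI⟩ := (hcB x y).1 hxy
    rw [hI.log_mul_inv_mem_iff, ← hqI, map_mul, ← hax, ← hby, map_mul, map_mul, ← mul_assoc,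
      mul_left_inj] at hgI
    -- Modulo `exp I` the relation reads `g a = b`, so `g` is congruent to `b / a`, which is close
    -- to `1`.
    have h1 : C.log (g * (b / a)⁻¹) ∈ I := by
      rw [hI.log_mul_inv_mem_iff, ← hqI, map_div, ← hgI, mul_div_cancel_right]
    have h2 := hdisc g hg _ (hsplit _ (interior_subset hb) _ (interior_subset ha)) h1
    have h3 : q g = 1 := (QuotientGroup.eq_one_iff g).2 h2
    rw [← hqI', ← hax, ← hby, map_mul, map_mul, ← hgI, h3, one_mul]

theorem IsIdeal.log_mul_exp_mul_inv_mem_iff (hI : C.IsIdeal I) (g : G) (v w : V) :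
    C.log (g * C.exp v * (C.exp w)⁻¹) ∈ I ↔ C.bch (C.log g) v - w ∈ I := by
  rw [hI.log_mul_inv_mem_iff, C.log_mul, log_exp, log_exp]

namespace LatticeCoordinates

variable {k : ℕ}

/-- The fibre coordinate of `v` is the coordinate of `exp v * (exp (P v))⁻¹`, an element of `exp I`.
Since `P` is constant on classes modulo `I`, two points of one class have fibre coordinates
differing by the coordinate of `exp v * (exp w)⁻¹`; this difference is integral exactly when an
element of `Γ` identifies them modulo `exp J`. -/
theorem isSmoothFiberBundle (L : LatticeCoordinates C Γ J I k) [FiniteDimensional ℝ V]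
    [IsTopologicalGroup G] {X B : Type*} [TopologicalSpace X] [TopologicalSpace B]
    {cX : V → X} {cB : V → B} {π : X → B}
    (hX : IsOpenQuotientMap cX) (hB : IsOpenQuotientMap cB) (hπ : ∀ v, π (cX v) = cB v)
    (hcX : ∀ v w, cX v = cX w ↔ ∃ g ∈ Γ, C.log (g * C.exp v * (C.exp w)⁻¹) ∈ J)
    (hcB : ∀ v w, cB v = cB w ↔ ∃ g ∈ Γ, C.log (g * C.exp v * (C.exp w)⁻¹) ∈ I)
    (hI : C.IsIdeal I) (hJ : C.IsIdeal J) (hJI : J ≤ I) (hIJ : ∀ x ∈ I, ∀ y ∈ I, C.br x y ∈ J)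
    (hd : C.DiscreteModulo Γ I) : IsSmoothFiberBundle cX cB (torusMk k) π := by
  obtain ⟨P, hP0, hPI⟩ := exists_linear_projection I
  have hPc : ContDiff ℝ ∞ P := (LinearMap.toContinuousLinearMap P).contDiff
  have hLc : ContDiff ℝ ∞ L.coord := (LinearMap.toContinuousLinearMap L.coord).contDiff
  have hSc : ContDiff ℝ ∞ L.lift := (LinearMap.toContinuousLinearMap L.lift).contDiff
  have hPeq : ∀ v w, v - w ∈ I → P v = P w := fun v w h => by
    rw [← sub_eq_zero, ← map_sub, hP0]; exact h
  have hlog : ∀ x y, C.bch x (-y) = C.log (C.exp x * (C.exp y)⁻¹) := fun x y => by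
    rw [← C.exp_neg, C.exp_mul, log_exp]
  have hmuR : ∀ v t, C.bch (L.lift t) (P v) - v ∈ I := fun v t => by
    have h1 := hI.bch_sub_bch_mem (x := L.lift t) (x' := 0) (by simpa using L.lift_mem t) (P v)
    have h2 : C.bch 0 (P v) = P v := by simp [bch]
    rw [h2] at h1
    have := I.add_mem h1 (hPI v)
    rwa [sub_add_sub_cancel] at this
  have hoff : ∀ v, C.log (C.exp v * (C.exp (P v))⁻¹) ∈ I := fun v => by
    rw [hI.log_mul_inv_mem_iff, log_exp, log_exp, ← neg_sub]
    exact I.neg_mem (hPI v)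
  refine isSmoothFiberBundle_of_local_coordinates (Γ := Γ) hX hB hπ
    (fun g v => C.bch (C.log g) v) (fun g => C.contDiff_bch contDiff_const contDiff_id) ?_
    (fun v w => v - w ∈ I) (fun v w h => by rw [← neg_sub]; exact I.neg_mem h)
    (fun v w z h h' => by have := I.add_mem h h'; rwa [sub_add_sub_cancel] at this) ?_
    (fun v => L.coord (C.bch v (-P v))) (hLc.comp (C.contDiff_bch contDiff_id hPc.neg)) ?_
    (fun p => C.bch (L.lift p.2) (P p.1))
    (C.contDiff_bch (hSc.comp contDiff_snd) (hPc.comp contDiff_fst)) hmuR ?_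
    (exists_saturated_nhd hI hd hcB)
  · rintro ⟨g, hg⟩ v
    rw [hcX]
    refine ⟨g⁻¹, Γ.inv_mem hg, ?_⟩
    have : g⁻¹ * C.exp (C.bch (C.log g) v) * (C.exp v)⁻¹ = 1 := by
      rw [← C.exp_mul, exp_log]; group
    rw [this, C.log_one]
    exact J.zero_mem
  · intro v w
    rw [hcB]
    simp only [hI.log_mul_exp_mul_inv_mem_iff, Subtype.exists, exists_prop]
  · intro v w hvw
    have hhI : C.log (C.exp v * (C.exp w)⁻¹) ∈ I := by
      rw [hI.log_mul_inv_mem_iff, log_exp, log_exp]; exact hvw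
    have hdiff : L.coord (C.bch v (-P v)) - L.coord (C.bch w (-P w)) =
        L.coord (C.log (C.exp v * (C.exp w)⁻¹)) := by
      have h1 := L.coord_log_mul hJ hJI hIJ hhI (hoff w)
      rw [← hPeq _ _ hvw, mul_assoc, inv_mul_cancel_left] at h1
      rw [← hPeq _ _ hvw, hlog, hlog, h1, add_sub_cancel_right]
    rw [torusMk_eq_iff, hdiff, hcX]
    have hmem : ∀ g, C.log (g * C.exp v * (C.exp w)⁻¹) ∈ J ↔ C.log g ∈ I ∧
        L.coord (C.log (C.exp v * (C.exp w)⁻¹)) = -L.coord (C.log g) := by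
      intro g
      rw [mul_assoc]
      constructor
      · intro h
        have hgI : C.log g ∈ I := by
          have := hI.subgroup.mul_mem (hJI h) (hI.subgroup.inv_mem hhI)
          rwa [mul_inv_cancel_right] at this
        have h1 := L.coord_log_mul hJ hJI hIJ hgI hhI
        rw [(L.coord_eq_zero_iff _ (hJI h)).2 h] at h1
        exact ⟨hgI, (neg_eq_of_add_eq_zero_right h1.symm).symm⟩
      · rintro ⟨hgI, h⟩
        rw [← L.coord_eq_zero_iff _ (hI.subgroup.mul_mem hgI hhI),
          L.coord_log_mul hJ hJI hIJ hgI hhI, h, add_neg_cancel]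
    simp only [hmem]
    constructor
    · rintro ⟨g, hg, hgI, h⟩
      obtain ⟨m, hm⟩ := L.coord_log g hg hgI
      exact ⟨-m, by rw [h, hm]; ext i; simp⟩
    · rintro ⟨m, hm⟩
      obtain ⟨g, hg, hgI, h⟩ := L.exists_coord_log (-m)
      exact ⟨g, hg, hgI, by rw [hm, h]; ext i; simp⟩
  · intro v t
    change L.coord (C.bch (C.bch (L.lift t) (P v)) (-P (C.bch (L.lift t) (P v)))) = t
    rw [hPeq _ _ (hmuR v t), hlog, ← C.exp_mul, mul_inv_cancel_right, log_exp, L.coord_lift]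

/-- Modulo `J` the group is abelian, so the lattice acts on the coordinates by integral translations
and the linear maps `coord` and `lift` descend. -/
theorem isDiffeomorphic_torus [FiniteDimensional ℝ V] {B : Type*} [TopologicalSpace B]
    {cB : V → B} (L : LatticeCoordinates C Γ J ⊤ k) (hJ : C.IsIdeal J)
    (hIJ : ∀ x y, C.br x y ∈ J) (hB : IsOpenQuotientMap cB)
    (hcB : ∀ v w, cB v = cB w ↔ ∃ g ∈ Γ, C.log (g * C.exp v * (C.exp w)⁻¹) ∈ J) :
    IsDiffeomorphic cB (torusMk k) := by
  refine isDiffeomorphic_of_smooth_maps hB (isOpenQuotientMap_torusMk k) (Φ := L.coord)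
    (Ψ := L.lift) (LinearMap.toContinuousLinearMap L.coord).contDiff
    (LinearMap.toContinuousLinearMap L.lift).contDiff ?_ fun t => by rw [L.coord_lift]
  intro v w
  have hmem : ∀ g, C.log (g * C.exp v * (C.exp w)⁻¹) ∈ J ↔
      L.coord v - L.coord w = -L.coord (C.log g) := by
    intro g
    have h1 := L.coord_log_mul hJ le_top (fun x _ y _ => hIJ x y) (g := g) (h := C.exp v)
      Submodule.mem_top Submodule.mem_top
    rw [log_exp] at h1
    rw [hJ.log_mul_inv_mem_iff, ← L.coord_eq_zero_iff _ Submodule.mem_top, map_sub, h1, log_exp,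
      add_sub_assoc, add_eq_zero_iff_neg_eq, eq_comm]
  rw [hcB, torusMk_eq_iff]
  simp only [hmem]
  constructor
  · rintro ⟨g, hg, h⟩
    obtain ⟨m, hm⟩ := L.coord_log g hg Submodule.mem_top
    exact ⟨-m, by rw [h, hm]; ext i; simp⟩
  · rintro ⟨m, hm⟩
    obtain ⟨g, hg, -, h⟩ := L.exists_coord_log (-m)
    exact ⟨g, hg, by rw [hm, h]; ext i; simp⟩

end LatticeCoordinates

end ExpCoordinates

attribute [local instance] LieRing.ofAssociativeRing

namespace Datum

variable {n : ℕ} (D : Datum n)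

/-! ### Exponential coordinates on `U` -/

/-- This allows the Lie algebra identities on `V` to be checked on matrices, where they follow from
associativity and the vanishing of fourfold products. -/
theorem mat_injective : Function.Injective D.mat := by
  intro v w h
  have h1 : ∀ i j, D.entry v i j = D.entry w i j := fun i j => congrFun (congrFun h i) j
  refine Prod.ext ?_ (Prod.ext (funext fun j => ?_) ?_)
  · exact h1 (.inl ()) (.inr (.inr (.inr ())))
  · exact h1 (.inr (.inl j)) (.inr (.inr (.inr ())))
  · exact h1 (.inr (.inr (.inl ()))) (.inr (.inr (.inr ())))

/-- The Lie bracket in the coordinates `(r, u, s)`. -/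
def bracketFun (v v' : V n) : V n :=
  (∑ j, star (D.γ v' j) * v.2.1 j - ∑ j, star (D.γ v j) * v'.2.1 j +
      Complex.I * (v'.2.2 * D.b v - v.2.2 * D.b v'),
    v'.2.2 • D.γ v - v.2.2 • D.γ v', 0)

theorem mat_bracketFun (v v' : V n) :
    D.mat (D.bracketFun v v') = D.mat v * D.mat v' - D.mat v' * D.mat v := by
  rw [← Ring.lie_def]
  exact (D.bracket_eq v v').symm

/-- The Lie bracket as a bilinear map. -/
def bracket : V n →ₗ[ℝ] V n →ₗ[ℝ] V n :=
  LinearMap.mk₂ ℝ D.bracketFun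
    (fun _ _ _ => D.mat_injective (by simp only [mat_bracketFun, map_add]; noncomm_ring))
    (fun _ _ _ => D.mat_injective (by
      simp only [mat_bracketFun, map_smul, smul_mul_assoc, mul_smul_comm, smul_sub]))
    (fun _ _ _ => D.mat_injective (by simp only [mat_bracketFun, map_add]; noncomm_ring))
    (fun _ _ _ => D.mat_injective (by
      simp only [mat_bracketFun, map_smul, smul_mul_assoc, mul_smul_comm, smul_sub]))

theorem mat_bracket (v v' : V n) :
    D.mat (D.bracket v v') = D.mat v * D.mat v' - D.mat v' * D.mat v := D.mat_bracketFun v v'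

theorem expU_mul_expU (v w : V n) : D.expU v * D.expU w = D.expU (v + w +
    (1 / 2 : ℝ) • D.bracket v w + (1 / 12 : ℝ) • D.bracket v (D.bracket v w) -
    (1 / 12 : ℝ) • D.bracket w (D.bracket v w)) := by
  refine Subtype.ext (Units.ext ?_)
  change NormedSpace.exp (D.mat v) * NormedSpace.exp (D.mat w) = NormedSpace.exp (D.mat _)
  have f : ∀ x ∈ ({v, w} : Set (V n)), ∀ y ∈ ({v, w} : Set (V n)), ∀ z ∈ ({v, w} : Set (V n)),
      ∀ t ∈ ({v, w} : Set (V n)), D.mat x * (D.mat y * (D.mat z * D.mat t)) = 0 :=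
    fun x _ y _ z _ t _ => D.mul_mul_mul_eq_zero x y z t
  simp only [Set.mem_insert_iff, Set.mem_singleton_iff, forall_eq_or_imp, forall_eq] at f
  rw [D.exp_mat, D.exp_mat, D.exp_mat]
  simp only [map_add, map_sub, map_smul, mat_bracket]
  simp only [mul_add, add_mul, mul_sub, sub_mul, smul_mul_assoc, mul_smul_comm, mul_assoc, f,
    mul_zero, smul_zero, smul_add, smul_sub, one_mul, mul_one, sub_zero, add_zero]
  module

open Sum in
/-- The inverse of the exponential map. -/
def logMat (M : Matrix (Idx n) (Idx n) ℂ) : V n :=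
  -- The entries of `1 + X + X²/2 + X³/6` are solved in turn: `s` and `γ` are read off unchanged,
  -- `u` is shifted by half of `γ s`, `β` recovers `i b`, and `r` comes last from the corner.
  let s := M (inr (inr (inl ()))) (inr (inr (inr ())))
  let g : W n := fun j => M (inr (inl j)) (inr (inr (inl ())))
  let u : W n := fun j => M (inr (inl j)) (inr (inr (inr ()))) - 1 / 2 * (g j * s)
  let β := M (inl ()) (inr (inr (inl ()))) + 1 / 2 * ∑ j, star (g j) * g j
  (M (inl ()) (inr (inr (inr ()))) - 1 / 2 * (β * s - ∑ j, star (g j) * u j) +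
    1 / 6 * ∑ j, star (g j) * (g j * s), u, s)

theorem logMat_exp (v : V n) : logMat (NormedSpace.exp (D.mat v)) = v := by
  have e34 : NormedSpace.exp (D.mat v) (.inr (.inr (.inl ()))) (.inr (.inr (.inr ()))) =
      v.2.2 := by
    rw [D.exp_mat]
    simp [mat, entry, Matrix.mul_apply, Fintype.sum_sum_type]
  have e23 : ∀ j, NormedSpace.exp (D.mat v) (.inr (.inl j)) (.inr (.inr (.inl ()))) =
      D.γ v j := by
    rw [D.exp_mat]
    simp [mat, entry, Matrix.mul_apply, Fintype.sum_sum_type]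
  have e24 : ∀ j, NormedSpace.exp (D.mat v) (.inr (.inl j)) (.inr (.inr (.inr ()))) =
      v.2.1 j + 1 / 2 * (D.γ v j * v.2.2) := by
    rw [D.exp_mat]
    simp [mat, entry, Matrix.mul_apply, Fintype.sum_sum_type]
  have e13 : NormedSpace.exp (D.mat v) (.inl ()) (.inr (.inr (.inl ()))) =
      Complex.I * D.b v - 1 / 2 * ∑ j, star (D.γ v j) * D.γ v j := by
    rw [D.exp_mat]
    simp [mat, entry, Matrix.mul_apply, Fintype.sum_sum_type, sub_eq_add_neg]
  have e14 : NormedSpace.exp (D.mat v) (.inl ()) (.inr (.inr (.inr ()))) =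
      v.1 + 1 / 2 * (Complex.I * D.b v * v.2.2 - ∑ j, star (D.γ v j) * v.2.1 j) -
        1 / 6 * ∑ j, star (D.γ v j) * (D.γ v j * v.2.2) := by
    rw [D.exp_mat]
    simp [mat, entry, Matrix.mul_apply, Fintype.sum_sum_type]
    ring
  simp only [logMat, e34, e23, e24, e13, e14, add_sub_cancel_right, sub_add_cancel]
  refine Prod.ext ?_ rfl
  ring

theorem continuous_logMat : Continuous (logMat (n := n)) := by
  unfold logMat
  fun_prop

/-- The exponential coordinates as a homeomorphism. -/
def expHomeomorph : V n ≃ₜ D.U where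
  toFun := D.expU
  invFun g := logMat (g : GL (Idx n) ℂ)
  left_inv v := D.logMat_exp v
  right_inv := by
    rintro ⟨g, X, ⟨v, rfl⟩, h⟩
    have h1 : (⟨g, D.mat v, ⟨v, rfl⟩, h⟩ : D.U) = D.expU v := Subtype.ext (Units.ext h)
    rw [h1]
    exact congrArg D.expU (D.logMat_exp v)
  continuous_toFun := by
    have hmat : Continuous D.mat := LinearMap.continuous_of_finiteDimensional _
    have hc : Continuous fun v => NormedSpace.exp (D.mat v) := by
      simp only [D.exp_mat]
      fun_prop
    exact Continuous.subtype_mk (Units.continuous_iff.2 ⟨hc, hc.comp continuous_neg⟩) _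
  continuous_invFun := continuous_logMat.comp (Units.continuous_val.comp continuous_subtype_val)

/-- The exponential coordinates on `U`. -/
def expCoordinates : ExpCoordinates (V n) D.U where
  br := D.bracket
  br_self x := D.mat_injective (by rw [mat_bracket, sub_self, map_zero])
  nil x y z w := D.mat_injective (by
    have h := D.mul_mul_mul_eq_zero
    simp only [mat_bracket, mul_sub, sub_mul, mul_assoc, h, sub_zero, map_zero])
  jacobi x y z := D.mat_injective (by simp only [mat_bracket, map_sub]; noncomm_ring)
  exp := D.expHomeomorph
  exp_mul_exp := D.expU_mul_expU

/-! ### The quotients of `Γ\U` -/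

section Quotients

theorem isOpenQuotientMap_cosetMk {G : Type*} [Group G] [TopologicalSpace G]
    [IsTopologicalGroup G] (Γ : Subgroup G) : IsOpenQuotientMap (cosetMk Γ) :=
  MulAction.isOpenQuotientMap_quotientMk (Γ := Γ)

theorem cosetMk_eq_iff {G : Type*} [Group G] (Γ : Subgroup G) (x y : G) :
    cosetMk Γ x = cosetMk Γ y ↔ ∃ g ∈ Γ, g * x * y⁻¹ = 1 := by
  rw [cosetMk, cosetMk, Quotient.eq, QuotientGroup.rightRel_apply]
  constructor
  · intro h
    exact ⟨_, h, by group⟩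
  · rintro ⟨g, hg, h⟩
    rw [mul_inv_eq_one] at h
    rwa [← h, mul_inv_cancel_right]

variable (Γ : Subgroup D.U)

theorem isOpenQuotientMap_chart : IsOpenQuotientMap (D.chart Γ) :=
  (isOpenQuotientMap_cosetMk Γ).comp D.expHomeomorph.isOpenQuotientMap

theorem isOpenQuotientMap_quotChart (i : ℕ) : IsOpenQuotientMap (D.quotChart Γ i) :=
  ((isOpenQuotientMap_cosetMk (D.imageLattice Γ i)).comp
    (QuotientGroup.isOpenQuotientMap_mk (N := D.lcs i))).comp D.expHomeomorph.isOpenQuotientMap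

theorem chart_eq_iff (v w : V n) : D.chart Γ v = D.chart Γ w ↔ ∃ g ∈ Γ, D.expCoordinates.log
    (g * D.expCoordinates.exp v * (D.expCoordinates.exp w)⁻¹) ∈ (⊥ : Submodule ℝ (V n)) := by
  rw [chart, chart, cosetMk_eq_iff]
  refine exists_congr fun g => and_congr_right fun _ => ?_
  rw [Submodule.mem_bot, ← D.expCoordinates.log_one, D.expCoordinates.exp.symm.injective.eq_iff]
  rfl

theorem quotChart_eq_iff {i : ℕ} {I : Submodule ℝ (V n)} (hI : D.expCoordinates.IsIdeal I)
    (h : D.lcs i = hI.subgroup) (v w : V n) :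
    D.quotChart Γ i v = D.quotChart Γ i w ↔ ∃ g ∈ Γ, D.expCoordinates.log
      (g * D.expCoordinates.exp v * (D.expCoordinates.exp w)⁻¹) ∈ I := by
  change cosetMk (D.imageLattice Γ i) (QuotientGroup.mk' (D.lcs i) (D.expU v)) =
    cosetMk _ (QuotientGroup.mk' (D.lcs i) (D.expU w)) ↔ _
  have hmem : ∀ g, D.expCoordinates.log (g * D.expCoordinates.exp v *
      (D.expCoordinates.exp w)⁻¹) ∈ I ↔ QuotientGroup.mk' (D.lcs i) g *
      QuotientGroup.mk' (D.lcs i) (D.expU v) * (QuotientGroup.mk' (D.lcs i) (D.expU w))⁻¹ = 1 := by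
    intro g
    rw [← hI.mem_subgroup, ← h]
    exact (QuotientGroup.eq_one_iff _).symm
  rw [cosetMk_eq_iff]
  simp only [hmem, imageLattice, Subgroup.mem_map, exists_exists_and_eq_and]

end Quotients

/-! ### The dimension of the derived algebra -/

theorem omega_I_smul_self (u : W n) : omega (Complex.I • u) u = ∑ j, Complex.normSq (u j) := by
  rw [omega_eq]
  refine Finset.sum_congr rfl fun j _ => ?_
  simp [Complex.normSq_apply]

/-- Multiplication by `i` on `W`. -/
def J : W n →ₗ[ℝ] W n where
  toFun u := Complex.I • u
  map_add' _ _ := smul_add _ _ _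
  map_smul' _ _ := smul_comm _ _ _

theorem J_injective : Function.Injective (J (n := n)) := fun u v h => by
  have h1 : Complex.I • u = Complex.I • v := h
  exact smul_right_injective _ Complex.I_ne_zero h1

/-- The complex subspace of `W` generated by the image of `γ₂`. -/
def complexRange : Submodule ℝ (W n) :=
  LinearMap.range D.γ₂ ⊔ (LinearMap.range D.γ₂).map J

theorem smul_γ₂_mem_complexRange (z : ℂ) (u : W n) : z • D.γ₂ u ∈ D.complexRange := by
  have h : z • D.γ₂ u = z.re • D.γ₂ u + z.im • J (D.γ₂ u) := by
    ext j
    simp only [J, LinearMap.coe_mk, AddHom.coe_mk, Pi.smul_apply, Pi.add_apply, smul_eq_mul,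
      Complex.real_smul]
    conv_lhs => rw [← Complex.re_add_im z]
    ring
  rw [h]
  exact Submodule.add_mem _
    (Submodule.smul_mem _ _ (le_sup_left (a := LinearMap.range D.γ₂) ⟨u, rfl⟩))
    (Submodule.smul_mem _ _ (le_sup_right (a := LinearMap.range D.γ₂) ⟨_, ⟨u, rfl⟩, rfl⟩))

/-- If `γ₂ u = i γ₂ u'`, isotropy gives `0 = ω (i γ₂ u', γ₂ u') = |γ₂ u'|²`. So the image of `γ₂` is
totally real. -/
theorem finrank_complexRange :
    Module.finrank ℝ D.complexRange = 2 * Module.finrank ℝ (LinearMap.range D.γ₂) := by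
  have hinf : LinearMap.range D.γ₂ ⊓ (LinearMap.range D.γ₂).map J = ⊥ := by
    rw [eq_bot_iff]
    rintro _ ⟨⟨u, rfl⟩, _, ⟨u', rfl⟩, h⟩
    have h1 := D.omega_γ₂ u u'
    have h2 : D.γ₂ u = Complex.I • D.γ₂ u' := h.symm
    rw [h2, omega_I_smul_self,
      Finset.sum_eq_zero_iff_of_nonneg fun j _ => Complex.normSq_nonneg _] at h1
    rw [h2]
    ext j
    have h3 := Complex.normSq_eq_zero.1 (h1 j (Finset.mem_univ j))
    simp [h3]
  have h1 := Submodule.finrank_sup_add_finrank_inf_eq (LinearMap.range D.γ₂)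
    ((LinearMap.range D.γ₂).map J)
  rw [hinf, finrank_bot,
    ← (Submodule.equivMapOfInjective J J_injective _).finrank_eq] at h1
  rw [complexRange]
  omega

theorem three_mul_finrank_range_γ₂_le :
    3 * Module.finrank ℝ (LinearMap.range D.γ₂) ≤ 2 * (n - 1) := by
  have hle : D.complexRange ≤ LinearMap.ker D.γ₂ := by
    refine sup_le ?_ ?_
    · rintro _ ⟨u, rfl⟩
      exact D.γ₂_γ₂ u
    · rintro _ ⟨_, ⟨u, rfl⟩, rfl⟩
      exact D.γ₂_J_γ₂ u
  have h1 := Submodule.finrank_mono hle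
  have h2 := D.γ₂.finrank_range_add_finrank_ker
  have h3 : Module.finrank ℝ (W n) = 2 * (n - 1) := by
    simp [Module.finrank_pi_fintype, Complex.finrank_real_complex, mul_comm]
  rw [D.finrank_complexRange] at h1
  omega

/-- With `d = rk γ₂`, the derived algebra has dimension at most `2 + (2 d + 1)`, and `3 d ≤ 2 (n -
1)` gives `9 + 6 d ≤ 4 n + 5`. -/
theorem three_mul_finrank_derived_le (hn : 1 ≤ n) :
    3 * Module.finrank ℝ D.expCoordinates.derived ≤ 4 * n + 5 := by
  -- By `swap_eq` the part of a bracket that comes from `γ₃` alone is a real multiple of this one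
  -- vector.
  let w : W n := (1 : ℂ) • (D.γ₃ (Complex.I * 1) - Complex.I • D.γ₃ 1)
  let M : Submodule ℝ (W n) := D.complexRange ⊔ Submodule.span ℝ {w}
  let φ : (ℂ × M) →ₗ[ℝ] V n := (LinearMap.fst ℝ ℂ M).prod
    ((M.subtype ∘ₗ LinearMap.snd ℝ ℂ M).prod 0)
  have hM : Module.finrank ℝ M ≤ 2 * Module.finrank ℝ (LinearMap.range D.γ₂) + 1 := by
    have h1 := Submodule.finrank_add_le_finrank_add_finrank D.complexRange (Submodule.span ℝ {w})
    have h2 := finrank_span_le_card (R := ℝ) ({w} : Set (W n))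
    simp only [Set.toFinset_singleton, Finset.card_singleton] at h2
    rw [D.finrank_complexRange] at h1
    exact h1.trans (by omega)
  have hle : D.expCoordinates.derived ≤ LinearMap.range φ := by
    refine Submodule.span_le.2 ?_
    rintro _ ⟨⟨v, v'⟩, rfl⟩
    have hmem : v'.2.2 • D.γ v - v.2.2 • D.γ v' ∈ M := by
      have h1 : v'.2.2 • D.γ v - v.2.2 • D.γ v' = v'.2.2 • D.γ₂ v.2.1 - v.2.2 • D.γ₂ v'.2.1 +
          (v'.2.2 • D.γ₃ v.2.2 - v.2.2 • D.γ₃ v'.2.2) := by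
        simp only [γ, LinearMap.coe_mk, AddHom.coe_mk, smul_add]; abel
      rw [h1, D.swap_eq]
      refine M.add_mem (M.sub_mem ?_ ?_) (M.smul_mem _ ?_)
      · exact le_sup_left (a := D.complexRange) (D.smul_γ₂_mem_complexRange _ _)
      · exact le_sup_left (a := D.complexRange) (D.smul_γ₂_mem_complexRange _ _)
      · exact le_sup_right (a := D.complexRange) (Submodule.mem_span_singleton_self w)
    exact ⟨(_, ⟨_, hmem⟩), rfl⟩
  have h1 := (Submodule.finrank_mono hle).trans φ.finrank_range_le
  rw [Module.finrank_prod, Complex.finrank_real_complex] at h1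
  have h2 := D.three_mul_finrank_range_γ₂_le
  omega

theorem finrank_V (hn : 1 ≤ n) : Module.finrank ℝ (V n) = 2 * n + 2 := by
  simp only [Module.finrank_prod, Complex.finrank_real_complex, Module.finrank_pi_fintype,
    Finset.sum_const, Finset.card_univ, Fintype.card_fin, smul_eq_mul]
  omega

end Datum

end HermiteLorentz

end

/-! ### Assembly of the tower of torus bundles -/

theorem mainTheorem12 (n : ℕ) (hn : 1 ≤ n) (D : HermiteLorentz.Datum n) (Γ : Subgroup D.U)
    (hΓ : HermiteLorentz.IsLattice Γ) :
    ∃ p q : ℕ, (2 * (n : ℝ) + 1) / 3 ≤ p ∧ p ≤ 2 * n + 2 ∧ p + q = 2 * n + 2 ∧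
      -- the base is a torus of dimension `p`, and the fibre is a torus of dimension `q`
      HermiteLorentz.IsDiffeomorphic (D.quotChart Γ 2) (HermiteLorentz.torusMk p) ∧
      HermiteLorentz.IsSmoothFiberBundle (D.chart Γ) (D.quotChart Γ 2) (HermiteLorentz.torusMk q)
        (D.proj Γ 2) ∧
      -- the fibration is the composition of two fibre bundles
      D.projThreeTwo Γ ∘ D.proj Γ 3 = D.proj Γ 2 ∧
      ∃ k l : ℕ, k + l = q ∧
        HermiteLorentz.IsSmoothFiberBundle (D.chart Γ) (D.quotChart Γ 3)
          (HermiteLorentz.torusMk k) (D.proj Γ 3) ∧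
        HermiteLorentz.IsSmoothFiberBundle (D.quotChart Γ 3) (D.quotChart Γ 2)
          (HermiteLorentz.torusMk l) (D.projThreeTwo Γ) := by
  have := hΓ.discrete
  let C := D.expCoordinates
  have hdim := HermiteLorentz.Datum.finrank_V hn
  have hd : 3 * Module.finrank ℝ C.derived ≤ 4 * n + 5 := D.three_mul_finrank_derived_le hn
  have h32 : C.derivedThree ≤ C.derived := C.derivedThree_le_derived
  have hle3 := Submodule.finrank_mono h32
  have hle2 := Submodule.finrank_le C.derived
  have hspan := HermiteLorentz.ExpCoordinates.span_logSet_top_sup_derived (C := C) hΓ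
  have hspan3 := HermiteLorentz.ExpCoordinates.derivedThree_le_span_logSet hspan
  have hspan2 := HermiteLorentz.ExpCoordinates.derived_le_span_logSet hspan
  have hbot : ∀ {I : Submodule ℝ (HermiteLorentz.V n)}, I ≤ C.derived →
      ∀ x ∈ I, ∀ y ∈ I, C.br x y = 0 :=
    fun hI x hx y hy => C.br_eq_zero_of_mem_derived (hI hx) (hI hy)
  have hbot' : ∀ {I : Submodule ℝ (HermiteLorentz.V n)}, I ≤ C.derived → ∀ x ∈ I, ∀ y ∈ I,
      C.br x y ∈ (⊥ : Submodule ℝ (HermiteLorentz.V n)) :=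
    fun hI x hx y hy => (Submodule.mem_bot ℝ).2 (hbot hI x hx y hy)
  have hI0 : C.IsIdeal ⊥ := HermiteLorentz.ExpCoordinates.isIdeal_bot
  have hI2 := C.isIdeal_derived
  have hI3 := C.isIdeal_derivedThree
  have hd0 : C.DiscreteModulo Γ ⊥ := HermiteLorentz.ExpCoordinates.discreteModulo_bot
  obtain ⟨L3⟩ := HermiteLorentz.ExpCoordinates.nonempty_latticeCoordinates
    (k := Module.finrank ℝ C.derivedThree)
    hI0 hI3 bot_le (hbot' h32) hd0 (hspan3.trans le_sup_left) (by simp)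
  obtain ⟨L2⟩ := HermiteLorentz.ExpCoordinates.nonempty_latticeCoordinates
    (k := Module.finrank ℝ C.derived)
    hI0 hI2 bot_le (hbot' le_rfl) hd0 (hspan2.trans le_sup_left) (by simp)
  -- The full lattices inside the two ideals yield discreteness modulo them, which the coordinates
  -- on the quotients `L32` and `L1` require.
  have hd3 : C.DiscreteModulo Γ C.derivedThree := L3.discreteModulo hI3 (hbot h32)
  have hd2 : C.DiscreteModulo Γ C.derived := L2.discreteModulo hI2 (hbot le_rfl)
  obtain ⟨L32⟩ := HermiteLorentz.ExpCoordinates.nonempty_latticeCoordinates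
    (k := Module.finrank ℝ C.derived - Module.finrank ℝ C.derivedThree)
    hI3 hI2 h32 (fun x hx y _ => C.br_mem_derivedThree hx y) hd3 (hspan2.trans le_sup_left)
    (by omega)
  obtain ⟨L1⟩ := HermiteLorentz.ExpCoordinates.nonempty_latticeCoordinates
    (k := 2 * n + 2 - Module.finrank ℝ C.derived)
    hI2 HermiteLorentz.ExpCoordinates.isIdeal_top le_top
    (fun x _ y _ => C.br_mem_derived x y) hd2 hspan.ge
    (by rw [finrank_top]; omega)
  -- The index shifts by one: `lcs i` is `lowerCentralSeries (i - 1)`, which starts at zero.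
  have hq2 := D.quotChart_eq_iff (i := 2) Γ hI2 C.lowerCentralSeries_one_eq
  have hq3 := D.quotChart_eq_iff (i := 3) Γ hI3 C.lowerCentralSeries_two_eq
  have hc := D.chart_eq_iff Γ
  have ho := D.isOpenQuotientMap_chart Γ
  have ho2 := D.isOpenQuotientMap_quotChart Γ 2
  have ho3 := D.isOpenQuotientMap_quotChart Γ 3
  have hcomp : D.projThreeTwo Γ ∘ D.proj Γ 3 = D.proj Γ 2 := by
    funext x
    obtain ⟨x, rfl⟩ := Quotient.exists_rep x
    rfl
  refine ⟨2 * n + 2 - Module.finrank ℝ C.derived, Module.finrank ℝ C.derived, ?_, by omega,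
    by omega, L1.isDiffeomorphic_torus hI2 C.br_mem_derived ho2 hq2,
    L2.isSmoothFiberBundle ho ho2 (fun _ => rfl) hc hq2 hI2 hI0 bot_le (hbot' le_rfl)
      hd2,
    hcomp, Module.finrank ℝ C.derivedThree,
    Module.finrank ℝ C.derived - Module.finrank ℝ C.derivedThree, by omega,
    L3.isSmoothFiberBundle ho ho3 (fun _ => rfl) hc hq3 hI3 hI0 bot_le (hbot' h32)
      hd3,
    L32.isSmoothFiberBundle ho3 ho2 (fun v => congrFun hcomp (D.chart Γ v)) hq3 hq2 hI2 hI3 h32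
      (fun x hx y _ => C.br_mem_derivedThree hx y) hd2⟩
  rw [div_le_iff₀ (by norm_num)]
  -- From `3 dim [𝔲, 𝔲] ≤ 4 n + 5` one gets `3 p ≥ 6 n + 6 - (4 n + 5) = 2 n + 1`.
  have h : 2 * n + 1 ≤ (2 * n + 2 - Module.finrank ℝ C.derived) * 3 := by omega
  exact_mod_cast h
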